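/- Let $M$ be a smooth manifold (Hausdorff, second countable, without boundary, of finite dimension $n$), let $C^\infty_M$ be its sheaf of smooth real-valued functions, and let $TM$ also denote the sheaf of smooth vector fields on $M$. For a commutative $\mathbb R$-algebra $R$, let $\mathrm{Diff}^0(R)$ be the set of $R$-linear maps $R\to R$ and, inductively, let $\mathrm{Diff}^{i+1}(R)$ be the set of $\mathbb R$-linear maps $D:R\to R$ such that $D\circ E-E\circ D\in \mathrm{Diff}^{i}(R)$ for all $E\in\mathrm{Diff}^0(R)$; put $\mathrm{Diff}^{-1}(R)=0$. The differential operators of order $i$ on $M$ form the sheaf $\mathrm{Diff}^i_M: U\mapsto \mathrm{Diff}^i(C^\infty(U))$, where for open $V\subseteq U$ the restriction $D|_V$ is the unique operator in $\mathrm{Diff}^i(C^\infty(V))$ with $D|_V(f|_V)=(Df)|_V$ for all $f\in C^\infty(U)$. Let $$\mathrm{Symb}^*(\mathrm{Diff}^\bullet_M)=\bigoplus_{i\ge 0}\mathrm{Symb}^i(\mathrm{Diff}^\bullet_M),\qquad \mathrm{Symb}^i(\mathrm{Diff}^\bullet_M)=\mathrm{Diff}^i_M/\mathrm{Diff}^{i-1}_M,$$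 be the associated graded sheaf of commutative $C^\infty_M$-algebras, with product induced by composition (quotients and direct sums are taken in the category of sheaves). Let $\mathrm{Sym}^*(TM)=\bigoplus_{i\ge 0}\mathrm{Sym}^i(TM)$ be the symmetric algebra of the $C^\infty_M$-module $TM$, that is, the sheaf of graded $C^\infty_M$-algebras associated with $U\mapsto \mathrm{Sym}^*_{C^\infty(U)}(TM(U))$. Theorem. The natural homomorphism of sheaves of graded commutative $C^\infty_M$-algebras $$\mathrm{Sym}^*(TM)\longrightarrow \mathrm{Symb}^*(\mathrm{Diff}^\bullet_M),$$ which sends a vector field $X$ on $U$ to the class of the derivation $f\mapsto df(X)$ in $\mathrm{Symb}^1$, is an isomorphism: it is an isomorphism of sheaves of $C^\infty_M$-algebras, and for every $i\ge 0$ its degree $i$ component $\mathrm{Sym}^i(TM)\to\mathrm{Symb}^i(\mathrm{Diff}^\bullet_M)$ is an isomorphism of sheaves of $C^\infty_M$-modules. Consequently $\mathrm{Symb}^*(\mathrm{Diff}^\bullet_M)$, and each $\mathrm{Symb}^i(\mathrm{Diff}^\bullet_M)$, is a locally free sheaf of $C^\infty_M$-modules. -/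

import Mathlib

open CategoryTheory TopologicalSpace Opposite
open scoped Manifold ContDiff

universe u

noncomputable section

/-! ### Grothendieck differential operators on a commutative algebra -/

namespace DiffOps

section Ring

variable (k R : Type*) [CommRing k] [CommRing R] [Algebra k R]

/-- The differential operators of order `0` on a commutative `k`-algebra `R`: the `k`-linear maps
`R → R` that are morphisms of `R`-modules. -/
def diffZero : Submodule R (Module.End k R) where
  carrier := {D | ∀ a b : R, D (a * b) = a * D b}
  add_mem' {D E} hD hE a b := by simp [hD a b, hE a b, mul_add]
  zero_mem' a b := by simp
  smul_mem' c D hD a b := by simp [hD a b, mul_left_comm]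

variable {k R} in
theorem mem_diffZero {D : Module.End k R} :
    D ∈ diffZero k R ↔ ∀ a b : R, D (a * b) = a * D b := Iff.rfl

/-- `diffOp k R i` is the `R`-module `Diff^i(R)` of differential operators of order (at most) `i`
on the commutative `k`-algebra `R`: a `k`-linear `D : R → R` lies in `Diff^(i+1)(R)` if
`D ∘ E - E ∘ D` lies in `Diff^i(R)` for every `E` in `Diff^0(R)`. -/
def diffOp : ℕ → Submodule R (Module.End k R)
  | 0 => diffZero k R
  | i + 1 =>
    { carrier := {D | ∀ E ∈ diffZero k R, D * E - E * D ∈ diffOp i}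
      add_mem' := fun {D D'} hD hD' E hE => by
        have h : (D + D') * E - E * (D + D') = (D * E - E * D) + (D' * E - E * D') := by
          noncomm_ring
        rw [h]
        exact add_mem (hD E hE) (hD' E hE)
      zero_mem' := fun E _ => by simp
      smul_mem' := fun c D hD E hE => by
        have h : (c • D) * E - E * (c • D) = c • (D * E - E * D) := by
          ext x
          have h1 : E (c * D x) = c * E (D x) := hE c (D x)
          simp [h1, mul_sub]
        rw [h]
        exact Submodule.smul_mem _ c (hD E hE) }

/-- The filtration shifted by one: `diffLT k R i` is `Diff^(i-1)(R)`, with `Diff^(-1)(R) = 0`. -/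
def diffLT : ℕ → Submodule R (Module.End k R)
  | 0 => ⊥
  | i + 1 => diffOp k R i

/-- Multiplication by `a`, as an operator of order `0`. -/
def mulOp (a : R) : Module.End k R := LinearMap.mulLeft k a

variable {k R}

@[simp] theorem mulOp_apply (a b : R) : mulOp k R a b = a * b := rfl

theorem mulOp_mem (a : R) : mulOp k R a ∈ diffZero k R := fun b c => by
  simp [mul_left_comm]

theorem eq_mulOp {E : Module.End k R} (hE : E ∈ diffZero k R) : E = mulOp k R (E 1) := by
  ext x
  simpa [mul_comm] using hE x 1

theorem mem_diffOp_zero {D : Module.End k R} :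
    D ∈ diffOp k R 0 ↔ ∀ a b : R, D (a * b) = a * D b := Iff.rfl

theorem mem_diffOp_succ {i : ℕ} {D : Module.End k R} :
    D ∈ diffOp k R (i + 1) ↔ ∀ a, D * mulOp k R a - mulOp k R a * D ∈ diffOp k R i := by
  constructor
  · intro h a
    exact h _ (mulOp_mem a)
  · intro h E hE
    rw [eq_mulOp hE]
    exact h _

theorem mem_diffLT_succ {i : ℕ} {D : Module.End k R} :
    D ∈ diffLT k R (i + 1) ↔ ∀ a, D * mulOp k R a - mulOp k R a * D ∈ diffLT k R i := by
  cases i with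
  | zero =>
    constructor
    · intro h a
      change _ = _
      ext x
      have h1 : D (a * x) = a * D x := h a x
      simp [h1]
    · intro h a b
      have h1 : _ = _ := h a
      have h2 := LinearMap.congr_fun h1 b
      simpa [sub_eq_zero] using h2
  | succ i => exact mem_diffOp_succ

theorem diffLT_le_succ (i : ℕ) : diffLT k R i ≤ diffLT k R (i + 1) := by
  induction i with
  | zero => exact bot_le
  | succ i ih =>
    intro D hD
    rw [mem_diffLT_succ] at hD ⊢
    exact fun a => ih (hD a)

theorem diffLT_le (i : ℕ) : diffLT k R i ≤ diffOp k R i := diffLT_le_succ i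

/-- Composition adds orders. -/
theorem mul_mem_aux : ∀ (N i j : ℕ), i + j = N → ∀ {D E : Module.End k R},
    D ∈ diffLT k R (i + 1) → E ∈ diffLT k R (j + 1) → D * E ∈ diffLT k R (N + 1) := by
  intro N
  induction N with
  | zero =>
    intro i j h D E hD hE
    obtain ⟨rfl, rfl⟩ : i = 0 ∧ j = 0 := by omega
    intro a b
    have h1 : E (a * b) = a * E b := hE a b
    have h2 : D (a * E b) = a * D (E b) := hD a (E b)
    simp [h1, h2]
  | succ N ih =>
    intro i j h D E hD hE
    rw [mem_diffLT_succ]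
    intro a
    have e : D * E * mulOp k R a - mulOp k R a * (D * E)
        = (D * mulOp k R a - mulOp k R a * D) * E
          + D * (E * mulOp k R a - mulOp k R a * E) := by
      simp only [mul_sub, sub_mul, mul_assoc]
      abel
    rw [e]
    refine add_mem ?_ ?_
    · have h1 := mem_diffLT_succ.1 hD a
      cases i with
      | zero =>
        have h2 : _ = _ := h1
        rw [h2, zero_mul]
        exact zero_mem _
      | succ i => exact ih i j (by omega) h1 hE
    · have h1 := mem_diffLT_succ.1 hE a
      cases j with
      | zero =>
        have h2 : _ = _ := h1
        rw [h2, mul_zero]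
        exact zero_mem _
      | succ j => exact ih i j (by omega) hD h1

theorem mul_mem {i j : ℕ} {D E : Module.End k R} (hD : D ∈ diffOp k R i)
    (hE : E ∈ diffOp k R j) : D * E ∈ diffOp k R (i + j) :=
  mul_mem_aux (i + j) i j rfl hD hE

theorem mul_mem_lt_left {i j : ℕ} {D E : Module.End k R} (hD : D ∈ diffLT k R i)
    (hE : E ∈ diffOp k R j) : D * E ∈ diffLT k R (i + j) := by
  cases i with
  | zero =>
    have h : D = 0 := hD
    rw [h, zero_mul]
    exact zero_mem _
  | succ i =>
    rw [Nat.succ_add]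
    exact mul_mem hD hE

theorem mul_mem_lt_right {i j : ℕ} {D E : Module.End k R} (hD : D ∈ diffOp k R i)
    (hE : E ∈ diffLT k R j) : D * E ∈ diffLT k R (i + j) := by
  cases j with
  | zero =>
    have h : E = 0 := hE
    rw [h, mul_zero]
    exact zero_mem _
  | succ j => exact mul_mem hD hE

/-- The commutator of operators of orders `i` and `j` has order `i + j - 1`. -/
theorem comm_mem_aux : ∀ (N i j : ℕ), i + j = N → ∀ {D E : Module.End k R},
    D ∈ diffLT k R (i + 1) → E ∈ diffLT k R (j + 1) → D * E - E * D ∈ diffLT k R N := by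
  intro N
  induction N with
  | zero =>
    intro i j h D E hD hE
    obtain ⟨rfl, rfl⟩ : i = 0 ∧ j = 0 := by omega
    rw [eq_mulOp (k := k) (R := R) hE]
    exact mem_diffLT_succ.1 hD _
  | succ N ih =>
    intro i j h D E hD hE
    rw [mem_diffLT_succ]
    intro a
    have e : (D * E - E * D) * mulOp k R a - mulOp k R a * (D * E - E * D)
        = ((D * mulOp k R a - mulOp k R a * D) * E - E * (D * mulOp k R a - mulOp k R a * D))
          + (D * (E * mulOp k R a - mulOp k R a * E)
              - (E * mulOp k R a - mulOp k R a * E) * D) := by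
      simp only [mul_sub, sub_mul, mul_assoc]
      abel
    rw [e]
    refine add_mem ?_ ?_
    · have h1 := mem_diffLT_succ.1 hD a
      cases i with
      | zero =>
        have h2 : _ = _ := h1
        rw [h2, zero_mul, mul_zero, sub_zero]
        exact zero_mem _
      | succ i => exact ih i j (by omega) h1 hE
    · have h1 := mem_diffLT_succ.1 hE a
      cases j with
      | zero =>
        have h2 : _ = _ := h1
        rw [h2, zero_mul, mul_zero, sub_zero]
        exact zero_mem _
      | succ j => exact ih i j (by omega) hD h1

theorem comm_mem {i j : ℕ} {D E : Module.End k R} (hD : D ∈ diffOp k R i)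
    (hE : E ∈ diffOp k R j) : D * E - E * D ∈ diffLT k R (i + j) :=
  comm_mem_aux (i + j) i j rfl hD hE

/-! ### The graded algebra of symbols -/

variable (k R) in
/-- The `R`-module `Diff^i(R)`, as a type. -/
def Diff (i : ℕ) : Type _ := diffOp k R i

instance Diff.addCommGroup (i : ℕ) : AddCommGroup (Diff k R i) :=
  Submodule.addCommGroup (diffOp k R i)

instance Diff.module (i : ℕ) : Module R (Diff k R i) :=
  Submodule.module (diffOp k R i)

variable (k R) in
/-- `Diff^(i-1)(R)` as a submodule of `Diff^i(R)`. -/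
def diffPrev (i : ℕ) : Submodule R (Diff k R i) where
  carrier := {D | D.1 ∈ diffLT k R i}
  add_mem' hD hE := add_mem (S := Submodule R (Module.End k R)) hD hE
  zero_mem' := zero_mem (diffLT k R i)
  smul_mem' a _ hD := Submodule.smul_mem _ a hD

variable (k R) in
/-- `Symb^i(R) = Diff^i(R) / Diff^(i-1)(R)`. -/
abbrev Symb (i : ℕ) : Type _ := Diff k R i ⧸ diffPrev k R i

/-- The class in `Symb^i(R)` of a differential operator of order `i`. -/
def Symb.mk {i : ℕ} (D : Module.End k R) (hD : D ∈ diffOp k R i) : Symb k R i :=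
  Submodule.Quotient.mk (p := diffPrev k R i) ⟨D, hD⟩

theorem Symb.mk_eq {i : ℕ} {D E : Module.End k R} {hD : D ∈ diffOp k R i}
    {hE : E ∈ diffOp k R i} : Symb.mk D hD = Symb.mk E hE ↔ D - E ∈ diffLT k R i :=
  Submodule.Quotient.eq (diffPrev k R i)

theorem Symb.ind {i : ℕ} {p : Symb k R i → Prop}
    (h : ∀ (D : Module.End k R) (hD : D ∈ diffOp k R i), p (Symb.mk D hD)) (x : Symb k R i) :
    p x := by
  obtain ⟨⟨D, hD⟩, rfl⟩ := Submodule.Quotient.mk_surjective _ x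
  exact h D hD

theorem Symb.mk_add {i : ℕ} {D E : Module.End k R} (hD : D ∈ diffOp k R i)
    (hE : E ∈ diffOp k R i) :
    Symb.mk D hD + Symb.mk E hE = Symb.mk (D + E) (add_mem hD hE) := rfl

theorem Symb.mk_zero {i : ℕ} : Symb.mk 0 (zero_mem _) = (0 : Symb k R i) := rfl

theorem Symb.smul_mk {i : ℕ} (a : R) {D : Module.End k R} (hD : D ∈ diffOp k R i) :
    a • Symb.mk D hD = Symb.mk (a • D) (Submodule.smul_mem _ a hD) := rfl

/-- The product `Symb^i(R) × Symb^j(R) → Symb^(i+j)(R)` induced by composition. -/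
def Symb.mul {i j : ℕ} (x : Symb k R i) (y : Symb k R j) : Symb k R (i + j) :=
  Quotient.map₂ (fun (D : Diff k R i) (E : Diff k R j) => ⟨D.1 * E.1, mul_mem D.2 E.2⟩)
    (fun D D' hD E E' hE => by
      have hD := (Submodule.quotientRel_def _).1 hD
      have hE := (Submodule.quotientRel_def _).1 hE
      refine (Submodule.quotientRel_def (diffPrev k R (i + j))).2 ?_
      have h : D.1 * E.1 - D'.1 * E'.1 = (D.1 - D'.1) * E.1 + D'.1 * (E.1 - E'.1) := by
        simp only [mul_sub, sub_mul]
        abel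
      change D.1 * E.1 - D'.1 * E'.1 ∈ diffLT k R (i + j)
      rw [h]
      exact add_mem (mul_mem_lt_left hD E.2) (mul_mem_lt_right D'.2 hE)) x y

theorem Symb.mk_mul {i j : ℕ} {D E : Module.End k R} (hD : D ∈ diffOp k R i)
    (hE : E ∈ diffOp k R j) :
    Symb.mul (Symb.mk D hD) (Symb.mk E hE) = Symb.mk (D * E) (mul_mem hD hE) := rfl

theorem one_mem : (1 : Module.End k R) ∈ diffOp k R 0 := fun _ _ => rfl

theorem Symb.sigma_eq {i j : ℕ} (h : i = j) {D E : Module.End k R} (hD : D ∈ diffOp k R i)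
    (hE : E ∈ diffOp k R j) (hDE : D - E ∈ diffLT k R i) :
    GradedMonoid.mk (A := Symb k R) i (Symb.mk D hD) = GradedMonoid.mk j (Symb.mk E hE) := by
  subst h
  rw [Symb.mk_eq.2 hDE]

instance Symb.gMul : GradedMonoid.GMul (Symb k R) where
  mul x y := Symb.mul x y

instance Symb.gOne : GradedMonoid.GOne (Symb k R) where
  one := Symb.mk 1 one_mem

instance Symb.gCommRing : DirectSum.GCommRing (Symb k R) where
  mul x y := Symb.mul x y
  one := Symb.mk 1 one_mem
  mul_zero {i j} x := by
    induction x using Symb.ind with | _ D hD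
    rw [← Symb.mk_zero, Symb.mk_mul, ← Symb.mk_zero, Symb.mk_eq]
    simp
  zero_mul {i j} x := by
    induction x using Symb.ind with | _ D hD
    rw [← Symb.mk_zero, Symb.mk_mul, ← Symb.mk_zero, Symb.mk_eq]
    simp
  mul_add {i j} x y z := by
    induction x using Symb.ind with | _ D hD
    induction y using Symb.ind with | _ E hE
    induction z using Symb.ind with | _ F hF
    simp only [Symb.mk_mul, Symb.mk_add, mul_add]
  add_mul {i j} x y z := by
    induction x using Symb.ind with | _ D hD
    induction y using Symb.ind with | _ E hE
    induction z using Symb.ind with | _ F hF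
    simp only [Symb.mk_mul, Symb.mk_add, add_mul]
  one_mul := by
    rintro ⟨i, x⟩
    induction x using Symb.ind with | _ D hD
    exact Symb.sigma_eq (zero_add i) _ _ (by simp)
  mul_one := by
    rintro ⟨i, x⟩
    induction x using Symb.ind with | _ D hD
    exact Symb.sigma_eq (add_zero i) _ _ (by simp)
  mul_assoc := by
    rintro ⟨i, x⟩ ⟨j, y⟩ ⟨l, z⟩
    induction x using Symb.ind with | _ D hD
    induction y using Symb.ind with | _ E hE
    induction z using Symb.ind with | _ F hF
    exact Symb.sigma_eq (add_assoc i j l) _ _ (by simp [mul_assoc])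
  mul_comm := by
    rintro ⟨i, x⟩ ⟨j, y⟩
    induction x using Symb.ind with | _ D hD
    induction y using Symb.ind with | _ E hE
    exact Symb.sigma_eq (add_comm i j) _ _ (comm_mem hD hE)
  natCast m := Symb.mk (m : Module.End k R) (by
    rw [← nsmul_one]; exact nsmul_mem one_mem m)
  natCast_zero := by
    rw [← Symb.mk_zero, Symb.mk_eq]
    simp
  natCast_succ m := by
    rw [Symb.mk_add, Symb.mk_eq]
    simp
  intCast m := Symb.mk (m : Module.End k R) (by
    rw [← zsmul_one]; exact zsmul_mem one_mem m)
  intCast_ofNat m := by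
    rw [Symb.mk_eq]
    simp
  intCast_negSucc_ofNat m := by
    change _ = Symb.mk (-((m + 1 : ℕ) : Module.End k R)) _
    rw [Symb.mk_eq]
    simp [Int.negSucc_eq]

theorem mulOp_mem' (a : R) : mulOp k R a ∈ diffOp k R 0 := mulOp_mem a

instance Symb.gAlgebra : DirectSum.GAlgebra R (Symb k R) where
  toFun :=
    { toFun := fun a => Symb.mk (mulOp k R a) (mulOp_mem' a)
      map_zero' := by
        rw [← Symb.mk_zero, Symb.mk_eq]
        simp [mulOp]
      map_add' := fun a b => by
        rw [Symb.mk_add, Symb.mk_eq]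
        have h : mulOp k R (a + b) - (mulOp k R a + mulOp k R b) = 0 := by
          ext x
          simp [add_mul]
        rw [h]
        exact zero_mem _ }
  map_one := by
    change Symb.mk _ _ = Symb.mk _ _
    rw [Symb.mk_eq]
    simp [mulOp, Module.End.one_eq_id]
  map_mul r s := by
    refine Symb.sigma_eq (zero_add 0).symm _ _ ?_
    simp [mulOp, LinearMap.mulLeft_mul, Module.End.mul_eq_comp]
  commutes r := by
    rintro ⟨i, x⟩
    induction x using Symb.ind with | _ D hD
    exact Symb.sigma_eq (add_comm 0 i) _ _ (comm_mem (mulOp_mem' r) hD)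
  smul_def r := by
    rintro ⟨i, x⟩
    induction x using Symb.ind with | _ D hD
    refine Symb.sigma_eq (zero_add i).symm _ _ ?_
    have h : r • D - mulOp k R r * D = 0 := by ext x; simp
    rw [h]
    exact zero_mem _

variable (k R) in
/-- The commutative graded `R`-algebra of symbols `Symb^*(R) = ⨁ i, Diff^i(R) / Diff^(i-1)(R)`. -/
abbrev SymbAlg : Type _ := DirectSum ℕ (Symb k R)

/-- A derivation is a differential operator of order `1`. -/
theorem derivation_mem (X : Derivation k R R) : (X : R →ₗ[k] R) ∈ diffOp k R 1 := by
  rw [mem_diffOp_succ]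
  intro a b c
  simp
  ring

variable (k R) in
/-- The `R`-linear map `Der(R) → Symb^1(R)`, `X ↦ X mod Diff^0(R)`. -/
def derToSymb : Derivation k R R →ₗ[R] Symb k R 1 where
  toFun X := Symb.mk (X : R →ₗ[k] R) (derivation_mem X)
  map_add' _ _ := rfl
  map_smul' _ _ := rfl

end Ring

/-! ### The degree `i` part of a symmetric algebra, functoriality -/

section Sym

variable {R S T : Type*} [CommRing R] [CommRing S] [CommRing T]
  {M N P : Type*} [AddCommGroup M] [Module R M] [AddCommGroup N] [Module S N]
  [AddCommGroup P] [Module T P]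

variable (R M) in
/-- `Sym^i_R(M)`, the submodule of the symmetric algebra that is spanned by the products of `i`
elements of `M`. -/
def symDeg (i : ℕ) : Submodule R (SymmetricAlgebra R M) :=
  LinearMap.range (SymmetricAlgebra.ι R M) ^ i

theorem sym_ringHom_ext {A : Type*} [CommRing A] {f g : SymmetricAlgebra R M →+* A}
    (h0 : ∀ r, f (algebraMap R _ r) = g (algebraMap R _ r))
    (h1 : ∀ m, f (SymmetricAlgebra.ι R M m) = g (SymmetricAlgebra.ι R M m)) : f = g := by
  refine RingHom.ext fun x => ?_
  induction x using SymmetricAlgebra.induction with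
  | algebraMap r => exact h0 r
  | ι x => exact h1 x
  | mul a b ha hb => simp [ha, hb]
  | add a b ha hb => simp [ha, hb]

/-- The ring homomorphism `Sym_R(M) → Sym_S(N)` induced by a ring homomorphism `φ : R → S` and a
`φ`-semilinear map `M → N`. -/
def symMap (φ : R →+* S) (f : M →ₛₗ[φ] N) : SymmetricAlgebra R M →+* SymmetricAlgebra S N :=
  letI : Algebra R (SymmetricAlgebra S N) :=
    ((algebraMap S (SymmetricAlgebra S N)).comp φ).toAlgebra
  (SymmetricAlgebra.lift (R := R) (A := SymmetricAlgebra S N)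
    { toFun := fun m => SymmetricAlgebra.ι S N (f m)
      map_add' := by simp
      map_smul' := fun r m => by
        simp [Algebra.smul_def, RingHom.algebraMap_toAlgebra] }).toRingHom

@[simp] theorem symMap_ι (φ : R →+* S) (f : M →ₛₗ[φ] N) (m : M) :
    symMap φ f (SymmetricAlgebra.ι R M m) = SymmetricAlgebra.ι S N (f m) := by
  let _ : Algebra R (SymmetricAlgebra S N) :=
    ((algebraMap S (SymmetricAlgebra S N)).comp φ).toAlgebra
  exact SymmetricAlgebra.lift_ι_apply _ m

@[simp] theorem symMap_algebraMap (φ : R →+* S) (f : M →ₛₗ[φ] N) (r : R) :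
    symMap φ f (algebraMap R _ r) = algebraMap S _ (φ r) := by
  let _ : Algebra R (SymmetricAlgebra S N) :=
    ((algebraMap S (SymmetricAlgebra S N)).comp φ).toAlgebra
  exact AlgHom.commutes (SymmetricAlgebra.lift (R := R) (A := SymmetricAlgebra S N) _) r

theorem symMap_smul (φ : R →+* S) (f : M →ₛₗ[φ] N) (r : R) (x : SymmetricAlgebra R M) :
    symMap φ f (r • x) = φ r • symMap φ f x := by
  simp [Algebra.smul_def]

theorem symMap_id (φ : R →+* R) (f : M →ₛₗ[φ] M) (hφ : ∀ r, φ r = r) (hf : ∀ m, f m = m) :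
    symMap φ f = RingHom.id _ :=
  sym_ringHom_ext (fun r => by simp [hφ]) (fun m => by simp [hf])

theorem symMap_comp {φ : R →+* S} {ψ : S →+* T} {χ : R →+* T} (f : M →ₛₗ[φ] N)
    (g : N →ₛₗ[ψ] P) (e : M →ₛₗ[χ] P) (hχ : ∀ r, χ r = ψ (φ r)) (he : ∀ m, e m = g (f m)) :
    symMap χ e = (symMap ψ g).comp (symMap φ f) :=
  sym_ringHom_ext (fun r => by simp [hχ]) (fun m => by simp [he])

theorem symMap_mem (φ : R →+* S) (f : M →ₛₗ[φ] N) (i : ℕ) :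
    ∀ x ∈ symDeg R M i, symMap φ f x ∈ symDeg S N i := by
  induction i with
  | zero =>
    intro x hx
    simp only [symDeg, pow_zero] at hx ⊢
    obtain ⟨r, rfl⟩ := Submodule.mem_one.1 hx
    exact Submodule.mem_one.2 ⟨φ r, by simp⟩
  | succ i ih =>
    intro x hx
    simp only [symDeg, pow_succ] at hx ih ⊢
    refine Submodule.mul_induction_on hx ?_ ?_
    · rintro a ha _ ⟨m, rfl⟩
      rw [map_mul, symMap_ι]
      exact Submodule.mul_mem_mul (ih a ha) ⟨f m, rfl⟩
    · intro a b ha hb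
      rw [map_add]
      exact add_mem ha hb

end Sym

/-! ### The symbol homomorphism over a ring -/

section SymbolHom

variable {k R : Type*} [CommRing k] [CommRing R] [Algebra k R]
  {M : Type*} [AddCommGroup M] [Module R M]

/-- For an `R`-linear map `ℓ : M → Der(R)`, the homomorphism of graded `R`-algebras
`Sym_R(M) → Symb^*(R)` that sends `m ∈ M` to the class of `ℓ m` in `Symb^1(R)`; for `ℓ = id` this
is the natural homomorphism `Sym_R(Der(R)) → Symb^*(R)`. -/
def symbolHom (ℓ : M →ₗ[R] Derivation k R R) : SymmetricAlgebra R M →ₐ[R] SymbAlg k R :=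
  SymmetricAlgebra.lift ((DirectSum.lof R ℕ (Symb k R) 1 ∘ₗ derToSymb k R) ∘ₗ ℓ)

theorem symbolHom_ι (ℓ : M →ₗ[R] Derivation k R R) (m : M) :
    symbolHom ℓ (SymmetricAlgebra.ι R M m) =
      DirectSum.of (Symb k R) 1 (derToSymb k R (ℓ m)) :=
  SymmetricAlgebra.lift_ι_apply _ m

/-- The symbol homomorphism preserves degrees. -/
theorem symbolHom_mem (ℓ : M →ₗ[R] Derivation k R R) (i : ℕ) :
    ∀ x ∈ symDeg R M i, ∃ y : Symb k R i, DirectSum.of (Symb k R) i y = symbolHom ℓ x := by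
  induction i with
  | zero =>
    intro x hx
    simp only [symDeg, pow_zero] at hx
    obtain ⟨r, rfl⟩ := Submodule.mem_one.1 hx
    exact ⟨_, ((symbolHom ℓ).commutes r).symm⟩
  | succ i ih =>
    intro x hx
    simp only [symDeg, pow_succ] at hx ih
    refine Submodule.mul_induction_on hx ?_ ?_
    · rintro a ha _ ⟨m, rfl⟩
      obtain ⟨y, hy⟩ := ih a ha
      refine ⟨GradedMonoid.GMul.mul y (derToSymb k R (ℓ m)), ?_⟩
      rw [map_mul, symbolHom_ι, ← hy, DirectSum.of_mul_of]
    · rintro a b ⟨y, hy⟩ ⟨z, hz⟩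
      exact ⟨y + z, by rw [map_add, map_add, hy, hz]⟩

/-- The degree `i` component `Sym^i_R(M) → Symb^i(R)` of the symbol homomorphism. -/
def symbolHomDeg (ℓ : M →ₗ[R] Derivation k R R) (i : ℕ) : symDeg R M i →ₗ[R] Symb k R i :=
  (DirectSum.component R ℕ (Symb k R) i ∘ₗ (symbolHom ℓ).toLinearMap) ∘ₗ (symDeg R M i).subtype

theorem of_symbolHomDeg (ℓ : M →ₗ[R] Derivation k R R) (i : ℕ) (x : symDeg R M i) :
    DirectSum.of (Symb k R) i (symbolHomDeg ℓ i x) = symbolHom ℓ x := by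
  obtain ⟨y, hy⟩ := symbolHom_mem ℓ i x.1 x.2
  have h : symbolHomDeg ℓ i x = y := by
    change (symbolHom ℓ x.1 : SymbAlg k R) i = y
    rw [← hy]
    exact DirectSum.of_eq_same i y
  rw [h, hy]

end SymbolHom

end DiffOps

/-! ### Restriction of differential operators on a manifold to open subsets -/

namespace DiffOps

section Manifold

variable {n : ℕ} {M : Type u} [TopologicalSpace M] [ChartedSpace (EuclideanSpace ℝ (Fin n)) M]

variable (n) in
/-- The ring `C^∞(U)` of smooth real-valued functions on an open subset `U` of `M`. -/
abbrev Smooth (U : Opens M) : Type u := C^∞⟮𝓡 n, U; 𝓘(ℝ, ℝ), ℝ⟯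

/-- Restriction `C^∞(U) → C^∞(V)` of smooth functions, for `V ⊆ U`. -/
def res {U V : Opens M} (h : V ≤ U) : Smooth n U →+* Smooth n V :=
  ContMDiffMap.restrictRingHom (𝓡 n) 𝓘(ℝ, ℝ) ℝ h

@[simp] theorem res_apply {U V : Opens M} (h : V ≤ U) (f : Smooth n U) (x : V) :
    res h f x = f (Set.inclusion h x) := rfl

theorem res_smul {U V : Opens M} (h : V ≤ U) (c : ℝ) (f : Smooth n U) :
    res h (c • f) = c • res h f := rfl

/-- Extension by zero of a function on `V`; it is smooth at the points of `V`. -/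
theorem exists_zext {V : Opens M} (g : Smooth n V) :
    ∀ y ∈ V, ContMDiffAt (𝓡 n) 𝓘(ℝ, ℝ) ∞
      (Function.extend (Subtype.val : V → M) g 0) y := by
  intro y hy
  have h : ContMDiffAt (𝓡 n) 𝓘(ℝ, ℝ) ∞
      (fun z : V => Function.extend (Subtype.val : V → M) g 0 z) ⟨y, hy⟩ := by
    have e : (fun z : V => Function.extend (Subtype.val : V → M) g 0 z) = g := by
      funext z
      exact Subtype.val_injective.extend_apply _ _ _
    rw [e]
    exact g.contMDiff.contMDiffAt
  exact contMDiffAt_subtype_iff.1 h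

variable [IsManifold (𝓡 n) ∞ M] [T2Space M]

/-- Smooth functions on `V ⊆ U` extend, after shrinking `V` around a point, to `U`. -/
theorem exists_extend {U V : Opens M} (h : V ≤ U) (x : V) :
    ∃ e : Smooth n V →ₗ[ℝ] Smooth n U, ∃ W : Set V, IsOpen W ∧ x ∈ W ∧
      ∀ g : Smooth n V, ∀ y ∈ W, e g (Set.inclusion h y) = g y := by
  classical
  set x' : U := Set.inclusion h x
  have hcont : Continuous (Set.inclusion h : V → U) := continuous_inclusion h
  have hV : Subtype.val ⁻¹' (V : Set M) ∈ nhds x' :=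
    (V.isOpen.preimage continuous_subtype_val).mem_nhds x.2
  obtain ⟨χ, -, hχ⟩ := (SmoothBumpFunction.nhds_basis_tsupport (I := 𝓡 n) x').mem_iff.1 hV
  have hsm : ∀ g : Smooth n V, ContMDiff (𝓡 n) 𝓘(ℝ, ℝ) ∞
      (fun y : U => χ y * Function.extend (Subtype.val : V → M) g 0 y) := by
    intro g
    refine contMDiff_of_tsupport fun y hy => ?_
    have hy' : y ∈ tsupport χ := by
      refine closure_mono ?_ hy
      intro z hz hz'
      exact hz (by simp [hz'])
    exact χ.contMDiffAt.mul (contMDiffAt_subtype_iff.2 (exists_zext g y (hχ hy')))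
  have hone : ∀ᶠ y in nhds x, χ (Set.inclusion h y) = (1 : U → ℝ) (Set.inclusion h y) :=
    hcont.continuousAt.eventually χ.eventuallyEq_one
  obtain ⟨W, hW, hWo, hxW⟩ := eventually_nhds_iff.1 hone
  refine ⟨{ toFun := fun g => ⟨_, hsm g⟩
            map_add' := fun f g => ?_
            map_smul' := fun c g => ?_ }, W, hWo, hxW, fun g y hy => ?_⟩
  · ext y
    change χ y * Function.extend (Subtype.val : V → M) (f + g) 0 y.1 = χ y * Function.extend (Subtype.val : V → M) f 0 y.1 + χ y * Function.extend (Subtype.val : V → M) g 0 y.1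
    by_cases hy : y.1 ∈ V
    · have e : ∀ k : V → ℝ, Function.extend (Subtype.val : V → M) k 0 y.1 = k ⟨y, hy⟩ :=
        fun k => Subtype.val_injective.extend_apply k 0 (⟨y, hy⟩ : V)
      simp [e, mul_add]
    · have e : ∀ k : V → ℝ, Function.extend (Subtype.val : V → M) k 0 y.1 = 0 :=
        fun k => Function.extend_apply' _ _ _ (by rintro ⟨z, hz⟩; exact hy (hz ▸ z.2))
      simp [e]
  · ext y
    change χ y * Function.extend (Subtype.val : V → M) (c • g) 0 y.1 = c * (χ y * Function.extend (Subtype.val : V → M) g 0 y.1)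
    by_cases hy : y.1 ∈ V
    · have e : ∀ k : V → ℝ, Function.extend (Subtype.val : V → M) k 0 y.1 = k ⟨y, hy⟩ :=
        fun k => Subtype.val_injective.extend_apply k 0 (⟨y, hy⟩ : V)
      simp [e, mul_left_comm]
    · have e : ∀ k : V → ℝ, Function.extend (Subtype.val : V → M) k 0 y.1 = 0 :=
        fun k => Function.extend_apply' _ _ _ (by rintro ⟨z, hz⟩; exact hy (hz ▸ z.2))
      simp [e]
  · change χ (Set.inclusion h y) * Function.extend (Subtype.val : V → M) g 0 y.1 = g y
    rw [hW y hy, Subtype.val_injective.extend_apply]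
    simp

/-- Differential operators are local. -/
theorem diffOp_local_zero {U : Opens M} (i : ℕ) : ∀ D ∈ diffOp ℝ (Smooth n U) i,
    ∀ (f : Smooth n U) (x : U), (∀ᶠ y in nhds x, f y = 0) → D f x = 0 := by
  induction i with
  | zero =>
    intro D hD f x hf
    have h : D (f * 1) = f * D 1 := hD f 1
    rw [mul_one] at h
    rw [h]
    change f x * D 1 x = 0
    rw [hf.self_of_nhds, zero_mul]
  | succ i ih =>
    intro D hD f x hf
    obtain ⟨χ, -, hχ⟩ := (SmoothBumpFunction.nhds_basis_tsupport (I := 𝓡 n) x).mem_iff.1 hf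
    set a : Smooth n U := ⟨χ, χ.contMDiff⟩
    have haf : a * f = 0 := by
      ext y
      change χ y * f y = 0
      by_cases hy : χ y = 0
      · rw [hy, zero_mul]
      · have h0 : f y = 0 := hχ (subset_tsupport _ hy)
        rw [h0, mul_zero]
    have h1 := ih _ (mem_diffOp_succ.1 hD a) f x hf
    have h2 : (D * mulOp ℝ _ a - mulOp ℝ _ a * D) f = D (a * f) - a * D f := rfl
    rw [h2, haf, map_zero, zero_sub] at h1
    have h3 : -(χ x * D f x) = 0 := h1
    rw [χ.eq_one] at h3
    linarith

theorem diffOp_local {U : Opens M} {i : ℕ} {D : Module.End ℝ (Smooth n U)}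
    (hD : D ∈ diffOp ℝ (Smooth n U) i) {f g : Smooth n U} {x : U}
    (h : ∀ᶠ y in nhds x, f y = g y) : D f x = D g x := by
  have h1 := diffOp_local_zero i D hD (f - g) x (h.mono fun y hy => by
    change f y - g y = 0
    rw [hy, sub_self])
  rw [map_sub] at h1
  exact sub_eq_zero.1 h1

/-- An operator on `C^∞(V)` that is local and that locally is the restriction of differential
operators of order `i` on `U ⊇ V` is a differential operator of order `i`. -/
theorem diffOp_of_locally {U V : Opens M} (h : V ≤ U) (i : ℕ) :
    ∀ E : Module.End ℝ (Smooth n V),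
    (∀ (f g : Smooth n V) (x : V), (∀ᶠ y in nhds x, f y = g y) → E f x = E g x) →
    (∀ x : V, ∃ D ∈ diffOp ℝ (Smooth n U) i, ∀ᶠ y in nhds x, ∀ f : Smooth n U,
      E (res h f) y = D f (Set.inclusion h y)) →
    E ∈ diffOp ℝ (Smooth n V) i := by
  induction i with
  | zero =>
    intro E hloc hE a b
    ext x
    obtain ⟨D, hD, hDE⟩ := hE x
    obtain ⟨e, W, hW, hxW, he⟩ := exists_extend (n := n) h x
    have hWx := hW.mem_nhds hxW
    have h1 : E (a * b) x = E (res h (e a * e b)) x := hloc _ _ _ (by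
      filter_upwards [hWx] with y hy
      change a y * b y = e a (Set.inclusion h y) * e b (Set.inclusion h y)
      rw [he a y hy, he b y hy])
    have h2 : E b x = E (res h (e b)) x := hloc _ _ _ (by
      filter_upwards [hWx] with y hy
      exact (he b y hy).symm)
    have h3 : D (e a * e b) = e a * D (e b) := hD _ _
    change E (a * b) x = a x * E b x
    rw [h1, h2, hDE.self_of_nhds, hDE.self_of_nhds, h3, ← he a x hxW]
    rfl
  | succ i ih =>
    intro E hloc hE
    rw [mem_diffOp_succ]
    intro a
    refine ih _ ?_ ?_
    · intro f g x hfg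
      change E (a * f) x - a x * E f x = E (a * g) x - a x * E g x
      rw [hloc f g x hfg, hloc (a * f) (a * g) x]
      filter_upwards [hfg] with y hy
      change a y * f y = a y * g y
      rw [hy]
    · intro x
      obtain ⟨D, hD, hDE⟩ := hE x
      obtain ⟨e, W, hW, hxW, he⟩ := exists_extend (n := n) h x
      refine ⟨_, mem_diffOp_succ.1 hD (e a), ?_⟩
      filter_upwards [hDE, hW.mem_nhds hxW] with y hy hyW f
      change E (a * res h f) y - a y * E (res h f) y
        = D (e a * f) (Set.inclusion h y) - e a (Set.inclusion h y) * D f (Set.inclusion h y)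
      rw [← hy, ← hy, he a y hyW, hloc (a * res h f) (res h (e a * f)) y]
      filter_upwards [hW.mem_nhds hyW] with z hz
      change a z * f (Set.inclusion h z) = e a (Set.inclusion h z) * f (Set.inclusion h z)
      rw [he a z hz]

/-- A differential operator on `V ⊆ U` is determined by its values on restrictions of functions
on `U`. -/
theorem diffOp_ext {U V : Opens M} (h : V ≤ U) {i j : ℕ} {E E' : Module.End ℝ (Smooth n V)}
    (hE : E ∈ diffOp ℝ (Smooth n V) i) (hE' : E' ∈ diffOp ℝ (Smooth n V) j)
    (hEE' : ∀ f : Smooth n U, E (res h f) = E' (res h f)) : E = E' := by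
  ext g x
  obtain ⟨e, W, hW, hxW, he⟩ := exists_extend (n := n) h x
  have hev : ∀ᶠ y in nhds x, g y = res h (e g) y := by
    filter_upwards [hW.mem_nhds hxW] with y hy
    exact (he g y hy).symm
  rw [diffOp_local hE hev, diffOp_local hE' hev, hEE']

/-- Differential operators can be restricted to open subsets. -/
theorem exists_restrict {U V : Opens M} (h : V ≤ U) {i : ℕ} (D : Module.End ℝ (Smooth n U))
    (hD : D ∈ diffOp ℝ (Smooth n U) i) :
    ∃ E ∈ diffOp ℝ (Smooth n V) i, ∀ f : Smooth n U, E (res h f) = res h (D f) := by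
  choose e W hW hxW he using fun x : V => exists_extend (n := n) h x
  have hcont : Continuous (Set.inclusion h : V → U) := continuous_inclusion h
  have key : ∀ (g : Smooth n V) (x : V) (f : Smooth n U),
      (∀ᶠ y in nhds x, f (Set.inclusion h y) = g y) →
      D (e x g) (Set.inclusion h x) = D f (Set.inclusion h x) := by
    intro g x f hf
    refine diffOp_local hD ?_
    have h1 : ∀ᶠ y in nhds x, e x g (Set.inclusion h y) = f (Set.inclusion h y) := by
      filter_upwards [hf, (hW x).mem_nhds (hxW x)] with y hy hyW
      rw [hy, he x g y hyW]
    obtain ⟨S, hS, hSo, hxS⟩ := eventually_nhds_iff.1 h1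
    obtain ⟨S', hS'o, rfl⟩ := isOpen_induced_iff.1 hSo
    have h2 : Subtype.val ⁻¹' (S' ∩ V) ∈ nhds (Set.inclusion h x) :=
      ((hS'o.inter V.isOpen).preimage continuous_subtype_val).mem_nhds ⟨hxS, x.2⟩
    filter_upwards [h2] with y hy
    exact hS ⟨y.1, hy.2⟩ hy.1
  have hsm : ∀ g : Smooth n V, ContMDiff (𝓡 n) 𝓘(ℝ, ℝ) ∞
      (fun x : V => D (e x g) (Set.inclusion h x)) := by
    intro g x
    have h1 : ContMDiffAt (𝓡 n) 𝓘(ℝ, ℝ) ∞ (res h (D (e x g))) x :=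
      (res h (D (e x g))).contMDiff.contMDiffAt
    refine h1.congr_of_eventuallyEq ?_
    filter_upwards [(hW x).mem_nhds (hxW x)] with y hy
    refine key g y (e x g) ?_
    filter_upwards [(hW x).mem_nhds hy] with z hz
    exact he x g z hz
  let E : Module.End ℝ (Smooth n V) :=
    { toFun := fun g => ⟨_, hsm g⟩
      map_add' := fun f g => by
        ext x
        change D (e x (f + g)) _ = D (e x f) _ + D (e x g) _
        rw [map_add, map_add]
        rfl
      map_smul' := fun c g => by
        ext x
        change D (e x (c • g)) _ = c • D (e x g) _
        rw [map_smul, map_smul]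
        rfl }
  have hres : ∀ f : Smooth n U, E (res h f) = res h (D f) := by
    intro f
    ext x
    exact key (res h f) x f (Filter.Eventually.of_forall fun _ => rfl)
  refine ⟨E, diffOp_of_locally h i E ?_ ?_, hres⟩
  · intro f g x hfg
    refine key f x (e x g) ?_
    filter_upwards [hfg, (hW x).mem_nhds (hxW x)] with y hy hyW
    rw [hy, he x g y hyW]
  · intro x
    refine ⟨D, hD, Filter.Eventually.of_forall fun y f => ?_⟩
    rw [hres]
    rfl

/-- The restriction `D|_V` of a differential operator `D` on `U` to `V ⊆ U`: the unique
differential operator on `V` with `D|_V (f|_V) = (D f)|_V` for all `f ∈ C^∞(U)`. -/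
def diffRes {U V : Opens M} (h : V ≤ U) {i : ℕ} (D : Diff ℝ (Smooth n U) i) :
    Diff ℝ (Smooth n V) i :=
  ⟨(exists_restrict h D.1 D.2).choose, (exists_restrict h D.1 D.2).choose_spec.1⟩

theorem diffRes_spec {U V : Opens M} (h : V ≤ U) {i : ℕ} (D : Diff ℝ (Smooth n U) i)
    (f : Smooth n U) : (diffRes h D).1 (res h f) = res h (D.1 f) :=
  (exists_restrict h D.1 D.2).choose_spec.2 f

theorem diffRes_eq {U V : Opens M} (h : V ≤ U) {i j : ℕ} (D : Diff ℝ (Smooth n U) i)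
    {E : Module.End ℝ (Smooth n V)} (hE : E ∈ diffOp ℝ (Smooth n V) j)
    (hDE : ∀ f : Smooth n U, E (res h f) = res h (D.1 f)) : (diffRes h D).1 = E :=
  diffOp_ext h (diffRes h D).2 hE fun f => by rw [diffRes_spec, hDE]

theorem diffRes_mem_lt {U V : Opens M} (h : V ≤ U) {i : ℕ} (D : Diff ℝ (Smooth n U) i)
    (hD : D.1 ∈ diffLT ℝ (Smooth n U) i) : (diffRes h D).1 ∈ diffLT ℝ (Smooth n V) i := by
  cases i with
  | zero =>
    have hD0 : D.1 = 0 := hD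
    refine diffRes_eq h D (j := 0) (zero_mem _) fun f => ?_
    rw [hD0]
    exact (map_zero (res h)).symm
  | succ i =>
    rw [diffRes_eq h D (diffRes h (i := i) ⟨D.1, hD⟩).2 fun f => diffRes_spec h ⟨D.1, hD⟩ f]
    exact (diffRes h (i := i) ⟨D.1, hD⟩).2

/-- Restriction of symbols, `Symb^i(C^∞(U)) → Symb^i(C^∞(V))` for `V ⊆ U`. -/
def symbRes {U V : Opens M} (h : V ≤ U) (i : ℕ) :
    Symb ℝ (Smooth n U) i →ₛₗ[res (n := n) h] Symb ℝ (Smooth n V) i :=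
  Submodule.mapQ (diffPrev ℝ (Smooth n U) i) (diffPrev ℝ (Smooth n V) i)
    { toFun := diffRes h
      map_add' := fun D E => Subtype.ext (diffRes_eq h _ (diffRes h D + diffRes h E).2 fun f => by
        change (diffRes h D).1 _ + (diffRes h E).1 _ = res h (D.1 f + E.1 f)
        rw [diffRes_spec, diffRes_spec, map_add])
      map_smul' := fun a D => Subtype.ext (diffRes_eq h _ (res h a • diffRes h D).2 fun f => by
        change res h a * (diffRes h D).1 _ = res h (a * D.1 f)
        rw [diffRes_spec, map_mul]) }
    (fun D hD => diffRes_mem_lt h D hD)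

theorem symbRes_mk {U V : Opens M} (h : V ≤ U) {i : ℕ} {D : Module.End ℝ (Smooth n U)}
    (hD : D ∈ diffOp ℝ (Smooth n U) i) {E : Module.End ℝ (Smooth n V)}
    (hE : E ∈ diffOp ℝ (Smooth n V) i) (hDE : ∀ f : Smooth n U, E (res h f) = res h (D f)) :
    symbRes h i (Symb.mk D hD) = Symb.mk E hE := by
  have h1 : (diffRes h (i := i) ⟨D, hD⟩) = ⟨E, hE⟩ := Subtype.ext (diffRes_eq h _ hE hDE)
  exact congrArg (Submodule.Quotient.mk (p := diffPrev ℝ (Smooth n V) i)) h1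

theorem symbRes_id {U : Opens M} (i : ℕ) (x : Symb ℝ (Smooth n U) i) :
    symbRes (le_refl U) i x = x := by
  induction x using Symb.ind with | _ D hD
  exact symbRes_mk _ hD hD fun f => rfl

theorem symbRes_comp {U V W : Opens M} (h : V ≤ U) (h' : W ≤ V) (i : ℕ)
    (x : Symb ℝ (Smooth n U) i) :
    symbRes (h'.trans h) i x = symbRes h' i (symbRes h i x) := by
  induction x using Symb.ind with | _ D hD
  let D₁ : Diff ℝ (Smooth n U) i := ⟨D, hD⟩
  rw [symbRes_mk h hD (diffRes h D₁).2 (diffRes_spec h D₁),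
    symbRes_mk h' _ (diffRes h' (diffRes h D₁)).2 (diffRes_spec h' _)]
  refine symbRes_mk _ hD _ fun f => ?_
  exact (diffRes_spec h' (diffRes h D₁) (res h f)).trans (congrArg (res h') (diffRes_spec h D₁ f))

/-- Restriction of symbols as a ring homomorphism `Symb^*(C^∞(U)) → Symb^*(C^∞(V))`. -/
def symbAlgRes {U V : Opens M} (h : V ≤ U) :
    SymbAlg ℝ (Smooth n U) →+* SymbAlg ℝ (Smooth n V) :=
  DirectSum.toSemiring
    (fun i => (DirectSum.of (Symb ℝ (Smooth n V)) i).comp (symbRes h i).toAddMonoidHom)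
    (by
      refine congrArg (DirectSum.of (Symb ℝ (Smooth n V)) 0) ?_
      exact symbRes_mk h one_mem one_mem fun f => rfl)
    (by
      intro i j x y
      induction x using Symb.ind with | _ D hD
      induction y using Symb.ind with | _ E hE
      let D₁ : Diff ℝ (Smooth n U) i := ⟨D, hD⟩
      let E₁ : Diff ℝ (Smooth n U) j := ⟨E, hE⟩
      change DirectSum.of _ (i + j) (symbRes h (i + j) (Symb.mk (D * E) (mul_mem hD hE)))
        = DirectSum.of _ i (symbRes h i (Symb.mk D hD))
          * DirectSum.of _ j (symbRes h j (Symb.mk E hE))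
      rw [DirectSum.of_mul_of, symbRes_mk h hD (diffRes h D₁).2 (diffRes_spec h D₁),
        symbRes_mk h hE (diffRes h E₁).2 (diffRes_spec h E₁),
        symbRes_mk h (mul_mem hD hE) (mul_mem (diffRes h D₁).2 (diffRes h E₁).2)]
      · rfl
      · intro f
        change (diffRes h D₁).1 ((diffRes h E₁).1 (res h f)) = res h (D₁.1 (E₁.1 f))
        rw [diffRes_spec, diffRes_spec])

@[simp] theorem symbAlgRes_of {U V : Opens M} (h : V ≤ U) (i : ℕ)
    (x : Symb ℝ (Smooth n U) i) :
    symbAlgRes h (DirectSum.of _ i x) = DirectSum.of _ i (symbRes h i x) :=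
  DirectSum.toSemiring_of _ _ _ i x

theorem symbAlgRes_id {U : Opens M} :
    symbAlgRes (n := n) (le_refl U) = RingHom.id _ :=
  DirectSum.ringHom_ext fun i x => by simp [symbRes_id]

theorem symbAlgRes_comp {U V W : Opens M} (h : V ≤ U) (h' : W ≤ V) :
    symbAlgRes (n := n) (h'.trans h) = (symbAlgRes h').comp (symbAlgRes h) :=
  DirectSum.ringHom_ext fun i x => by simp [symbRes_comp h h']

theorem symbAlgRes_algebraMap {U V : Opens M} (h : V ≤ U) (a : Smooth n U) :
    symbAlgRes h (algebraMap _ (SymbAlg ℝ (Smooth n U)) a)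
      = algebraMap _ (SymbAlg ℝ (Smooth n V)) (res h a) := by
  refine (symbAlgRes_of h 0 _).trans ?_
  refine congrArg (DirectSum.of (Symb ℝ (Smooth n V)) 0) ?_
  exact symbRes_mk h _ _ fun f => (map_mul (res h) a f).symm

end Manifold

end DiffOps

/-! ### The tangent sheaf -/

namespace DiffOps

section VectorFields

variable {n : ℕ} {M : Type u} [TopologicalSpace M] [ChartedSpace (EuclideanSpace ℝ (Fin n)) M]

theorem mdiff {U : Opens M} (f : Smooth n U) (x : U) :
    MDifferentiableAt (𝓡 n) 𝓘(ℝ, ℝ) f x :=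
  (f.contMDiff x).mdifferentiableAt (by simp)

/-- The inclusion map `V → U` of open subsets `V ⊆ U`. -/
def incl {U V : Opens M} (h : V ≤ U) : V → U := Set.inclusion h

theorem hasMFDerivAt_incl {U V : Opens M} (h : V ≤ U) (x : V) :
    HasMFDerivAt (𝓡 n) (𝓡 n) (incl h) x (mfderiv (𝓡 n) (𝓡 n) (incl h) x) :=
  ((contMDiff_inclusion (n := ∞) h x).mdifferentiableAt (by simp)).hasMFDerivAt

theorem mfderiv_incl_isInvertible {U V : Opens M} (h : V ≤ U) (x : V) :
    (mfderiv (𝓡 n) (𝓡 n) (incl h) x).IsInvertible := by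
  classical
  let r : U → V := fun y => if hy : y.1 ∈ V then ⟨y.1, hy⟩ else x
  have hr : ∀ y : V, r (incl h y) = y := fun y => dif_pos y.2
  have hev : ∀ᶠ y in nhds (incl h x), incl h (r y) = y := by
    filter_upwards [(V.isOpen.preimage continuous_subtype_val).mem_nhds
      (show incl h x ∈ Subtype.val ⁻¹' (V : Set M) from x.2)] with y hy
    have h1 : r y = ⟨y.1, hy⟩ := dif_pos hy
    rw [h1]
    rfl
  have hrs : ContMDiffAt (𝓡 n) (𝓡 n) ∞ r (incl h x) := by
    rw [← ContMDiffAt.subtypeVal_comp_iff]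
    refine (contMDiff_subtype_val (n := ∞) (incl h x)).congr_of_eventuallyEq ?_
    filter_upwards [hev] with y hy
    exact congrArg Subtype.val hy
  have hrd := (hrs.mdifferentiableAt (by simp)).hasMFDerivAt
  set A : EuclideanSpace ℝ (Fin n) →L[ℝ] EuclideanSpace ℝ (Fin n) :=
    mfderiv (𝓡 n) (𝓡 n) (incl h) x with hA
  set B : EuclideanSpace ℝ (Fin n) →L[ℝ] EuclideanSpace ℝ (Fin n) :=
    mfderiv (𝓡 n) (𝓡 n) r (incl h x) with hB
  have h1 : B.comp A = ContinuousLinearMap.id ℝ _ := by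
    have e1 : HasMFDerivAt (𝓡 n) (𝓡 n) (r ∘ incl h) x (B.comp A) :=
      HasMFDerivAt.comp x hrd (hasMFDerivAt_incl h x)
    have e2 : r ∘ incl h = id := funext hr
    rw [e2] at e1
    exact hasMFDerivAt_unique e1 (hasMFDerivAt_id x)
  have h2 : A.comp B = ContinuousLinearMap.id ℝ _ := by
    have e0 : ∀ z, z = x → HasMFDerivAt (𝓡 n) (𝓡 n) (incl h) z A := by
      rintro z rfl
      exact hasMFDerivAt_incl h z
    have e1 : HasMFDerivAt (𝓡 n) (𝓡 n) (incl h ∘ r) (incl h x) (A.comp B) :=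
      HasMFDerivAt.comp (incl h x) (e0 _ (hr x)) hrd
    exact hasMFDerivAt_unique (e1.congr_of_eventuallyEq (hev.mono fun y hy => hy.symm))
      (hasMFDerivAt_id _)
  exact ContinuousLinearMap.IsInvertible.of_inverse h2 h1

variable [IsManifold (𝓡 n) ∞ M]

variable (n) in
/-- The smooth vector fields on an open subset `U` of `M`: the sections of the tangent sheaf. -/
abbrev VecField (U : Opens M) : Type u :=
  Cₛ^∞⟮𝓡 n; EuclideanSpace ℝ (Fin n), (TangentSpace (𝓡 n) : U → Type _)⟯

/-- Vector fields on `U` form a module over `C^∞(U)`. -/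
instance VecField.module (U : Opens M) : Module (Smooth n U) (VecField n U) where
  smul f X := ⟨fun x => f x • X x, f.contMDiff.smul_section X.contMDiff⟩
  one_smul X := by ext x; exact one_smul ℝ (X x)
  mul_smul f g X := by ext x; exact mul_smul (f x) (g x) (X x)
  smul_zero f := by ext x; exact smul_zero (f x)
  smul_add f X Y := by ext x; exact smul_add (f x) (X x) (Y x)
  add_smul f g X := by ext x; exact add_smul (f x) (g x) (X x)
  zero_smul X := by ext x; exact zero_smul ℝ (X x)

theorem vecField_smul_apply {U : Opens M} (f : Smooth n U) (X : VecField n U) (x : U) :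
    (f • X) x = f x • X x := rfl

theorem contMDiff_dapply {U : Opens M} (X : VecField n U) (f : Smooth n U) :
    ContMDiff (𝓡 n) 𝓘(ℝ, ℝ) ∞
      (fun x : U => (mfderiv (𝓡 n) 𝓘(ℝ, ℝ) f x (X x) : ℝ)) := by
  have h1 : ContMDiff (𝓡 n).tangent 𝓘(ℝ, ℝ).tangent ∞ (tangentMap (𝓡 n) 𝓘(ℝ, ℝ) f) :=
    f.contMDiff.contMDiff_tangentMap (by simp)
  exact (contMDiff_snd_tangentBundle_modelSpace ℝ 𝓘(ℝ, ℝ)).comp (h1.comp X.contMDiff)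

/-- The derivation `f ↦ X f = df(X)` of `C^∞(U)` given by a vector field `X` on `U`. -/
def lieDer (U : Opens M) :
    VecField n U →ₗ[Smooth n U] Derivation ℝ (Smooth n U) (Smooth n U) where
  toFun X := Derivation.mk'
    { toFun := fun f => ⟨_, contMDiff_dapply X f⟩
      map_add' := fun f g => by
        ext x
        change mfderiv (𝓡 n) 𝓘(ℝ, ℝ) (⇑f + ⇑g) x (X x) = _
        rw [mfderiv_add (mdiff f x) (mdiff g x)]
        rfl
      map_smul' := fun c f => by
        ext x
        change mfderiv (𝓡 n) 𝓘(ℝ, ℝ) (c • ⇑f) x (X x) = _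
        rw [const_smul_mfderiv (mdiff f x)]
        rfl }
    (fun f g => by
      ext x
      change mfderiv (𝓡 n) 𝓘(ℝ, ℝ) (⇑f * ⇑g) x (X x) = _
      rw [((mdiff f x).hasMFDerivAt.mul (mdiff g x).hasMFDerivAt).mfderiv]
      rfl)
  map_add' X Y := by
    ext f x
    exact map_add (mfderiv (𝓡 n) 𝓘(ℝ, ℝ) f x) (X x) (Y x)
  map_smul' a X := by
    ext f x
    exact map_smul (mfderiv (𝓡 n) 𝓘(ℝ, ℝ) f x) (a x) (X x)

theorem lieDer_apply {U : Opens M} (X : VecField n U) (f : Smooth n U) (x : U) :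
    lieDer U X f x = mfderiv (𝓡 n) 𝓘(ℝ, ℝ) f x (X x) := rfl

/-- Restriction of vector fields from `U` to `V ⊆ U`: the pullback along the inclusion. -/
def vecRes {U V : Opens M} (h : V ≤ U) : VecField n U →ₛₗ[res (n := n) h] VecField n V where
  toFun X := ⟨VectorField.mpullback (𝓡 n) (𝓡 n) (incl h) X,
    ContMDiff.mpullback_vectorField (n := ∞) X.contMDiff (contMDiff_inclusion h)
      (mfderiv_incl_isInvertible h) (by simp)⟩
  map_add' X Y := by
    ext x
    exact map_add (mfderiv (𝓡 n) (𝓡 n) (incl h) x).inverse (X (incl h x)) (Y (incl h x))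
  map_smul' a X := by
    ext x
    exact map_smul (mfderiv (𝓡 n) (𝓡 n) (incl h) x).inverse (a (incl h x)) (X (incl h x))

/-- The defining property of the restriction: `dι (X|_V) = X` for the inclusion `ι : V → U`. -/
theorem mfderiv_incl_vecRes {U V : Opens M} (h : V ≤ U) (X : VecField n U) (x : V) :
    mfderiv (𝓡 n) (𝓡 n) (incl h) x (vecRes h X x) = X (incl h x) := by
  have hA := mfderiv_incl_isInvertible (n := n) h x
  exact hA.self_apply_inverse _

theorem vecField_ext_incl {U V : Opens M} (h : V ≤ U) {X Y : VecField n V}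
    (hXY : ∀ x, mfderiv (𝓡 n) (𝓡 n) (incl h) x (X x) = mfderiv (𝓡 n) (𝓡 n) (incl h) x (Y x)) :
    X = Y := by
  ext x
  exact (mfderiv_incl_isInvertible (n := n) h x).injective (hXY x)

theorem vecRes_id {U : Opens M} (X : VecField n U) : vecRes (le_refl U) X = X := by
  refine vecField_ext_incl (le_refl U) fun x => ?_
  rw [mfderiv_incl_vecRes]
  have e : (incl (le_refl U) : U → U) = id := rfl
  rw [e, mfderiv_id]
  rfl

theorem vecRes_comp {U V W : Opens M} (h : V ≤ U) (h' : W ≤ V) (X : VecField n U) :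
    vecRes (h'.trans h) X = vecRes h' (vecRes h X) := by
  refine vecField_ext_incl (h'.trans h) fun x => ?_
  rw [mfderiv_incl_vecRes]
  have e : HasMFDerivAt (𝓡 n) (𝓡 n) (incl (h'.trans h)) x
      ((mfderiv (𝓡 n) (𝓡 n) (incl h) (incl h' x)).comp (mfderiv (𝓡 n) (𝓡 n) (incl h') x)) :=
    HasMFDerivAt.comp (f := incl h') x (hasMFDerivAt_incl h (incl h' x)) (hasMFDerivAt_incl h' x)
  rw [e.mfderiv]
  change _ = mfderiv (𝓡 n) (𝓡 n) (incl h) (incl h' x)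
    (mfderiv (𝓡 n) (𝓡 n) (incl h') x (vecRes h' (vecRes h X) x))
  rw [mfderiv_incl_vecRes, mfderiv_incl_vecRes]
  rfl

/-- `X|_V (f|_V) = (X f)|_V`. -/
theorem lieDer_res {U V : Opens M} (h : V ≤ U) (X : VecField n U) (f : Smooth n U) :
    lieDer V (vecRes h X) (res h f) = res h (lieDer U X f) := by
  ext x
  have e : HasMFDerivAt (𝓡 n) 𝓘(ℝ, ℝ) (res h f) x
      ((mfderiv (𝓡 n) 𝓘(ℝ, ℝ) f (incl h x)).comp (mfderiv (𝓡 n) (𝓡 n) (incl h) x)) :=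
    HasMFDerivAt.comp (f := incl h) x (mdiff f (incl h x)).hasMFDerivAt (hasMFDerivAt_incl h x)
  rw [lieDer_apply, e.mfderiv]
  exact congrArg (mfderiv (𝓡 n) 𝓘(ℝ, ℝ) f (incl h x)) (mfderiv_incl_vecRes h X x)

end VectorFields

end DiffOps

/-! ### The sheaves -/

namespace DiffOps

section Sheaves

variable (n : ℕ) (M : Type u) [TopologicalSpace M] [ChartedSpace (EuclideanSpace ℝ (Fin n)) M]

/-- The presheaf `U ↦ C^∞(U)` of commutative rings on `M`. -/
def smoothPresheaf : (Opens M)ᵒᵖ ⥤ CommRingCat.{u} where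
  obj U := CommRingCat.of (Smooth n U.unop)
  map f := CommRingCat.ofHom (res (leOfHom f.unop))

/-- Smoothness is a local property. -/
def smoothLocalPredicate : TopCat.LocalPredicate fun _ : TopCat.of M => ℝ where
  pred {U : Opens M} := fun f : U → ℝ => ContMDiff (𝓡 n) 𝓘(ℝ, ℝ) ∞ f
  res := by
    intro U V i f hf
    exact hf.comp (contMDiff_inclusion (leOfHom i))
  locality := by
    intro V f hf x
    obtain ⟨U, hxU, i, hU⟩ := hf x
    have hUV : U ≤ V := leOfHom i
    have hG := contDiffWithinAt_localInvariantProp (I := 𝓡 n) (I' := 𝓘(ℝ, ℝ)) ∞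
    have h1 := hU ⟨x.1, hxU⟩
    have h2 : ChartedSpace.LiftPropAt (ContDiffWithinAtProp (𝓡 n) 𝓘(ℝ, ℝ) ∞) f
        (Opens.inclusion hUV ⟨x.1, hxU⟩) :=
      (hG.liftPropAt_iff_comp_inclusion hUV f ⟨x.1, hxU⟩).2 h1
    exact h2

theorem smoothPresheaf_isSheaf :
    Presheaf.IsSheaf (Opens.grothendieckTopology M) (smoothPresheaf n M) := by
  rw [Presheaf.isSheaf_iff_isSheaf_forget _ _ (forget CommRingCat)]
  exact (TopCat.subsheafToTypes (smoothLocalPredicate n M)).property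

/-- The sheaf `C^∞_M` of smooth functions on `M`, a sheaf of commutative rings. -/
def smoothSheaf : Sheaf (Opens.grothendieckTopology M) CommRingCat.{u} :=
  ⟨smoothPresheaf n M, smoothPresheaf_isSheaf n M⟩

/-- `C^∞_M` as a sheaf of rings. -/
def smoothRingSheaf : Sheaf (Opens.grothendieckTopology M) RingCat.{u} :=
  (sheafCompose _ (forget₂ CommRingCat.{u} RingCat.{u})).obj (smoothSheaf n M)

variable [IsManifold (𝓡 n) ∞ M]

/-- The presheaf `U ↦ Sym_{C^∞(U)}(TM(U))`. -/
def symPresheaf : (Opens M)ᵒᵖ ⥤ CommRingCat.{u} where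
  obj U := CommRingCat.of (SymmetricAlgebra (Smooth n U.unop) (VecField n U.unop))
  map f := CommRingCat.ofHom (symMap (res (leOfHom f.unop)) (vecRes (leOfHom f.unop)))
  map_id _ := CommRingCat.hom_ext (symMap_id _ _ (fun _ => rfl) vecRes_id)
  map_comp f g := CommRingCat.hom_ext
    (symMap_comp _ _ _ (fun _ => rfl) (vecRes_comp (leOfHom f.unop) (leOfHom g.unop)))

/-- The structure map `C^∞(U) → Sym_{C^∞(U)}(TM(U))`. -/
def symStructure : smoothPresheaf n M ⟶ symPresheaf n M where
  app U := CommRingCat.ofHom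
    (algebraMap (Smooth n U.unop) (SymmetricAlgebra (Smooth n U.unop) (VecField n U.unop)))
  naturality _ _ f := CommRingCat.hom_ext (RingHom.ext fun r =>
    (symMap_algebraMap (res (leOfHom f.unop)) (vecRes (leOfHom f.unop)) r).symm)

variable [T2Space M]

/-- The presheaf `U ↦ Symb^*(C^∞(U)) = ⨁ i, Diff^i(C^∞(U)) / Diff^(i-1)(C^∞(U))`. -/
def symbPresheaf : (Opens M)ᵒᵖ ⥤ CommRingCat.{u} where
  obj U := CommRingCat.of (SymbAlg ℝ (Smooth n U.unop))
  map f := CommRingCat.ofHom (symbAlgRes (leOfHom f.unop))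
  map_id _ := CommRingCat.hom_ext symbAlgRes_id
  map_comp f g := CommRingCat.hom_ext (symbAlgRes_comp (leOfHom f.unop) (leOfHom g.unop))

/-- The structure map `C^∞(U) → Symb^*(C^∞(U))`. -/
def symbStructure : smoothPresheaf n M ⟶ symbPresheaf n M where
  app U := CommRingCat.ofHom (algebraMap (Smooth n U.unop) (SymbAlg ℝ (Smooth n U.unop)))
  naturality _ _ f := CommRingCat.hom_ext (RingHom.ext fun r =>
    (symbAlgRes_algebraMap (leOfHom f.unop) r).symm)

variable {n M} in
/-- The symbol homomorphism is compatible with restriction. -/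
theorem symbolHom_res {U V : Opens M} (h : V ≤ U)
    (x : SymmetricAlgebra (Smooth n U) (VecField n U)) :
    symbolHom (lieDer V) (symMap (res h) (vecRes h) x) =
      symbAlgRes h (symbolHom (lieDer U) x) := by
  have key : ((symbolHom (lieDer (n := n) V)).toRingHom.comp (symMap (res h) (vecRes h))) =
      (symbAlgRes h).comp (symbolHom (lieDer (n := n) U)).toRingHom := by
    refine sym_ringHom_ext (fun r => ?_) (fun X => ?_)
    · change symbolHom (lieDer V) (symMap (res h) (vecRes h) (algebraMap _ _ r))
        = symbAlgRes h (symbolHom (lieDer U) (algebraMap _ _ r))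
      rw [symMap_algebraMap, AlgHom.commutes, AlgHom.commutes, symbAlgRes_algebraMap]
    · change symbolHom (lieDer V) (symMap (res h) (vecRes h) (SymmetricAlgebra.ι _ _ X))
        = symbAlgRes h (symbolHom (lieDer U) (SymmetricAlgebra.ι _ _ X))
      rw [symMap_ι, symbolHom_ι, symbolHom_ι, symbAlgRes_of]
      refine congrArg _ ?_
      exact (symbRes_mk h (derivation_mem (lieDer U X)) (derivation_mem (lieDer V (vecRes h X)))
        fun f => lieDer_res h X f).symm
  exact RingHom.congr_fun key x

/-- The symbol homomorphism, as a morphism of presheaves of rings: on `U` it is the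
homomorphism of `C^∞(U)`-algebras `Sym_{C^∞(U)}(TM(U)) → Symb^*(C^∞(U))` that sends a vector field
`X` to the class of the derivation `f ↦ df(X)` in `Diff^1 / Diff^0`. -/
def symbolPresheafMap : symPresheaf n M ⟶ symbPresheaf n M where
  app U := CommRingCat.ofHom (symbolHom (lieDer U.unop)).toRingHom
  naturality _ _ f := CommRingCat.hom_ext (RingHom.ext fun x =>
    symbolHom_res (leOfHom f.unop) x)

theorem symStructure_comp :
    symStructure n M ≫ symbolPresheafMap n M = symbStructure n M := by
  ext U r
  exact (symbolHom (lieDer U.unop)).commutes r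

/-- The sheaf of commutative `C^∞_M`-algebras associated with a presheaf of commutative
`C^∞_M`-algebras. -/
def sheafAlgebra {P : (Opens M)ᵒᵖ ⥤ CommRingCat.{u}} (s : smoothPresheaf n M ⟶ P) :
    Under (smoothSheaf n M) :=
  Under.mk (Y := (presheafToSheaf (Opens.grothendieckTopology M) CommRingCat.{u}).obj P)
    ⟨s ≫ toSheafify (Opens.grothendieckTopology M) P⟩

/-- `Sym^*(TM)`, a sheaf of commutative `C^∞_M`-algebras. -/
def symSheaf : Under (smoothSheaf n M) := sheafAlgebra n M (symStructure n M)

/-- `Symb^*(Diff^•_M)`, a sheaf of commutative `C^∞_M`-algebras. -/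
def symbSheaf : Under (smoothSheaf n M) := sheafAlgebra n M (symbStructure n M)

/-- The natural homomorphism `Sym^*(TM) → Symb^*(Diff^•_M)` of sheaves of `C^∞_M`-algebras. -/
def symbolMap : symSheaf n M ⟶ symbSheaf n M :=
  Under.homMk ((presheafToSheaf (Opens.grothendieckTopology M) CommRingCat.{u}).map
    (symbolPresheafMap n M)) (by
      refine Sheaf.hom_ext ?_
      change (symStructure n M ≫ toSheafify _ _) ≫ sheafifyMap _ (symbolPresheafMap n M)
        = symbStructure n M ≫ toSheafify _ _
      rw [Category.assoc, ← toSheafify_naturality, ← Category.assoc, symStructure_comp])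

end Sheaves

end DiffOps

/-! ### The graded pieces, as sheaves of modules -/

namespace DiffOps

section Modules

variable (n : ℕ) (M : Type u) [TopologicalSpace M] [ChartedSpace (EuclideanSpace ℝ (Fin n)) M]
  [IsManifold (𝓡 n) ∞ M]

/-- The presheaf of `C^∞_M`-modules `U ↦ Sym^i_{C^∞(U)}(TM(U))`. -/
def symDegPresheaf (i : ℕ) : PresheafOfModules.{u} (smoothRingSheaf n M).obj where
  obj U := ModuleCat.of (Smooth n U.unop) (symDeg (Smooth n U.unop) (VecField n U.unop) i)
  map {U V} f := ModuleCat.ofHom (R := Smooth n U.unop)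
    (Y := (ModuleCat.restrictScalars (res (leOfHom f.unop))).obj
      (ModuleCat.of (Smooth n V.unop) (symDeg (Smooth n V.unop) (VecField n V.unop) i)))
    { toFun := fun x => ⟨symMap (res (leOfHom f.unop)) (vecRes (leOfHom f.unop)) x.1,
        symMap_mem _ _ i x.1 x.2⟩
      map_add' := fun x y => Subtype.ext (map_add _ x.1 y.1)
      map_smul' := fun a x => Subtype.ext (symMap_smul _ _ a x.1) }
  map_id U := by
    refine ModuleCat.hom_ext (LinearMap.ext fun x => Subtype.ext ?_)
    exact congrArg (fun g => g.hom x.1) ((symPresheaf n M).map_id U)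
  map_comp f g := by
    refine ModuleCat.hom_ext (LinearMap.ext fun x => Subtype.ext ?_)
    exact congrArg (fun g => g.hom x.1) ((symPresheaf n M).map_comp f g)

variable [T2Space M]

/-- The presheaf of `C^∞_M`-modules `U ↦ Symb^i(C^∞(U)) = Diff^i(C^∞(U)) / Diff^(i-1)(C^∞(U))`. -/
def symbDegPresheaf (i : ℕ) : PresheafOfModules.{u} (smoothRingSheaf n M).obj where
  obj U := ModuleCat.of (Smooth n U.unop) (Symb ℝ (Smooth n U.unop) i)
  map {U V} f := ModuleCat.ofHom (R := Smooth n U.unop)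
    (Y := (ModuleCat.restrictScalars (res (leOfHom f.unop))).obj
      (ModuleCat.of (Smooth n V.unop) (Symb ℝ (Smooth n V.unop) i)))
    { toFun := fun x => symbRes (leOfHom f.unop) i x
      map_add' := fun x y => map_add _ x y
      map_smul' := fun a x => LinearMap.map_smulₛₗ (symbRes (leOfHom f.unop) i) a x }
  map_id U := ModuleCat.hom_ext (LinearMap.ext fun x => symbRes_id i x)
  map_comp f g := ModuleCat.hom_ext (LinearMap.ext fun x =>
    symbRes_comp (leOfHom f.unop) (leOfHom g.unop) i x)

/-- The degree `i` part `Sym^i → Symb^i` of the symbol homomorphism, on presheaves. -/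
def symbolDegPresheafMap (i : ℕ) : symDegPresheaf n M i ⟶ symbDegPresheaf n M i where
  app U := ModuleCat.ofHom (R := Smooth n U.unop) (symbolHomDeg (lieDer U.unop) i)
  naturality {_ V} f := by
    refine ModuleCat.hom_ext (LinearMap.ext fun x => ?_)
    refine DirectSum.of_injective (β := Symb ℝ (Smooth n V.unop)) i ?_
    refine (of_symbolHomDeg (lieDer V.unop) i _).trans ?_
    refine (symbolHom_res (leOfHom f.unop) x.1).trans ?_
    refine (congrArg (symbAlgRes _) (of_symbolHomDeg (lieDer _) i x)).symm.trans ?_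
    exact symbAlgRes_of (leOfHom f.unop) i _

/-- The associated sheaf of a presheaf of `C^∞_M`-modules. -/
abbrev sheafModules :
    PresheafOfModules.{u} (smoothRingSheaf n M).obj ⥤ SheafOfModules.{u} (smoothRingSheaf n M) :=
  PresheafOfModules.sheafification (𝟙 (smoothRingSheaf n M).obj)

/-- The sheaf of `C^∞_M`-modules `Sym^i(TM)`. -/
def symSheafDeg (i : ℕ) : SheafOfModules.{u} (smoothRingSheaf n M) :=
  (sheafModules n M).obj (symDegPresheaf n M i)

/-- The sheaf of `C^∞_M`-modules `Symb^i(Diff^•_M) = Diff^i_M / Diff^(i-1)_M`. -/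
def symbSheafDeg (i : ℕ) : SheafOfModules.{u} (smoothRingSheaf n M) :=
  (sheafModules n M).obj (symbDegPresheaf n M i)

/-- The degree `i` component `Sym^i(TM) → Symb^i(Diff^•_M)` of the natural homomorphism: it is
induced by the restriction of the homomorphism of graded algebras
`Sym^*_{C^∞(U)}(TM(U)) → Symb^*(C^∞(U))` to the parts of degree `i` (see `of_symbolHomDeg`). -/
def symbolMapDeg (i : ℕ) : symSheafDeg n M i ⟶ symbSheafDeg n M i :=
  (sheafModules n M).map (symbolDegPresheafMap n M i)

variable {n M} in
/-- The sheaf of `C^∞_M`-modules underlying a sheaf of commutative `C^∞_M`-algebras. -/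
def toModules (A : Under (smoothSheaf n M)) : SheafOfModules.{u} (smoothRingSheaf n M) :=
  (SheafOfModules.restrictScalars
    ((sheafCompose _ (forget₂ CommRingCat.{u} RingCat.{u})).map A.hom)).obj (SheafOfModules.unit _)

end Modules

end DiffOps

end

/-!
# Symbols of differential operators on a manifold

The statement is local, and on an open subset `V` of the domain of a chart it holds already for
sections. There the chart provides coordinates `x j` in `C^∞(V)` and coordinate vector fields
`X j`, which form a basis of the vector fields on `V`, so that the symmetric algebra is a polynomial
ring in the `X j`. The commutator `D ↦ D ∘ x j - x j ∘ D` lowers the order of operators and induces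
a derivation of the algebra of symbols (`symbBracket`), which corresponds to the partial derivative
in the `j`-th variable of polynomials (`IsCoordFrame.symbBracket_polySymb`).

* Injectivity: the coefficients of a polynomial are, up to nonzero integers, iterated partial
  derivatives evaluated at `0`, so a polynomial with symbol zero vanishes
  (`IsCoordFrame.polySymb_injective`).
* Surjectivity: a symbol of positive degree all of whose brackets with coordinates vanish is zero
  (`IsCoordFrame.mem_diffLT`). By induction on the degree this reduces to operators of order `1`,
  where it is Hadamard's lemma: near a point `p` a smooth function differs from its value at `p` by
  a combination of the functions `x j - x j p` (`hadamard`, `isCoordFrame_chart`). Hence symbols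
  satisfy Euler's identity (`IsCoordFrame.euler`), which expresses a symbol of degree `i + 1`
  through symbols of degree `i` and the `X j`.

Thus the symbol homomorphism is bijective on the open subsets of chart domains, and it becomes an
isomorphism after sheafification. Moreover the monomials in the `X j` are bases of the symbols that
are compatible with restriction. A morphism from the associated sheaf to any sheaf of modules is
then the same as a family of sections indexed by the monomials, so over the chart domain the
associated sheaf is free (`SheafOfModules.isLocallyFree_of_basis`).
-/

noncomputable section

/-! ### The algebra of symbols -/

namespace DiffOps

section Algebra

variable {k R : Type*} [CommRing k] [CommRing R] [Algebra k R]

/-- Classes of operators in the algebra of symbols agree when they agree up to lower order. -/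
theorem Symb.of_mk_eq {i j : ℕ} (h : i = j) {D E : Module.End k R} (hD : D ∈ diffOp k R i)
    (hE : E ∈ diffOp k R j) (hDE : D - E ∈ diffLT k R i) :
    DirectSum.of (Symb k R) i (Symb.mk D hD) = DirectSum.of (Symb k R) j (Symb.mk E hE) := by
  subst h
  rw [Symb.mk_eq.2 hDE]

theorem Symb.of_mk_mul {i j : ℕ} {D E : Module.End k R} (hD : D ∈ diffOp k R i)
    (hE : E ∈ diffOp k R j) :
    DirectSum.of (Symb k R) i (Symb.mk D hD) * DirectSum.of (Symb k R) j (Symb.mk E hE) =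
      DirectSum.of (Symb k R) (i + j) (Symb.mk (D * E) (mul_mem hD hE)) :=
  DirectSum.of_mul_of _ _

theorem Symb.algebraMap_eq (a : R) :
    algebraMap R (SymbAlg k R) a =
      DirectSum.of (Symb k R) 0 (Symb.mk (mulOp k R a) (mulOp_mem' a)) := rfl

theorem Symb.induction_of {p : SymbAlg k R → Prop} (zero : p 0)
    (add : ∀ x y, p x → p y → p (x + y))
    (of : ∀ (i : ℕ) (D : Module.End k R) (hD : D ∈ diffOp k R i),
      p (DirectSum.of (Symb k R) i (Symb.mk D hD))) (x : SymbAlg k R) : p x := by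
  induction x using DirectSum.induction_on with
  | zero => exact zero
  | of i y =>
    induction y using Symb.ind with | _ D hD
    exact of i D hD
  | add x y hx hy => exact add x y hx hy

/-! ### Commutators with functions, on symbols -/

/-- The map `Symb^(i+1)(R) → Symb^i(R)` induced by `D ↦ D ∘ a - a ∘ D`. -/
def Symb.bracket (a : R) (i : ℕ) : Symb k R (i + 1) →ₗ[R] Symb k R i :=
  Submodule.mapQ (diffPrev k R (i + 1)) (diffPrev k R i)
    { toFun := fun D => ⟨D.1 * mulOp k R a - mulOp k R a * D.1, mem_diffOp_succ.1 D.2 a⟩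
      map_add' := fun D E => Subtype.ext (by
        change (D.1 + E.1) * mulOp k R a - mulOp k R a * (D.1 + E.1) =
          (D.1 * mulOp k R a - mulOp k R a * D.1) + (E.1 * mulOp k R a - mulOp k R a * E.1)
        noncomm_ring)
      map_smul' := fun c D => Subtype.ext (LinearMap.ext fun x => by
        change c * D.1 (a * x) - a * (c * D.1 x) = c * (D.1 (a * x) - a * D.1 x)
        ring) }
    (fun _ hD => mem_diffLT_succ.1 hD a)

/-- The derivation of the algebra of symbols induced by `D ↦ D ∘ a - a ∘ D`: it lowers the degree
by one and vanishes in degree `0`. For symbols written as polynomials in a frame dual to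
coordinates `x`, bracketing with `x j` is the partial derivative in the `j`-th variable. -/
def symbBracket (a : R) : SymbAlg k R →ₗ[R] SymbAlg k R :=
  DirectSum.toModule R ℕ (SymbAlg k R) fun
    | 0 => 0
    | i + 1 => DirectSum.lof R ℕ (Symb k R) i ∘ₗ Symb.bracket a i

theorem symbBracket_of_zero (a : R) (x : Symb k R 0) :
    symbBracket a (DirectSum.of (Symb k R) 0 x) = 0 :=
  DirectSum.toModule_lof R (M := Symb k R) 0 x

theorem symbBracket_of_succ (a : R) {i : ℕ} (x : Symb k R (i + 1)) :
    symbBracket a (DirectSum.of (Symb k R) (i + 1) x) =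
      DirectSum.of (Symb k R) i (Symb.bracket a i x) :=
  DirectSum.toModule_lof R (M := Symb k R) (i + 1) x

theorem symbBracket_of_mk (a : R) {i j : ℕ} (h : i = j + 1) {D : Module.End k R}
    (hD : D ∈ diffOp k R i) (hD' : D * mulOp k R a - mulOp k R a * D ∈ diffOp k R j) :
    symbBracket a (DirectSum.of (Symb k R) i (Symb.mk D hD)) =
      DirectSum.of (Symb k R) j (Symb.mk (D * mulOp k R a - mulOp k R a * D) hD') := by
  subst h
  exact symbBracket_of_succ a _

theorem symbBracket_algebraMap (a r : R) :
    symbBracket a (algebraMap R (SymbAlg k R) r) = 0 :=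
  symbBracket_of_zero a _

/-- The Jacobi identity for two multiplication operators, which commute. -/
theorem bracket_bracket_comm (D : Module.End k R) (a b : R) :
    (D * mulOp k R a - mulOp k R a * D) * mulOp k R b
        - mulOp k R b * (D * mulOp k R a - mulOp k R a * D) =
      (D * mulOp k R b - mulOp k R b * D) * mulOp k R a
        - mulOp k R a * (D * mulOp k R b - mulOp k R b * D) := by
  ext x
  simp only [LinearMap.sub_apply, Module.End.mul_apply, mulOp_apply, mul_sub]
  rw [mul_left_comm a b x, mul_left_comm a b (D x)]
  abel

theorem symbBracket_comm (a b : R) (x : SymbAlg k R) :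
    symbBracket a (symbBracket b x) = symbBracket b (symbBracket a x) := by
  induction x using Symb.induction_of with
  | zero => simp
  | add x y hx hy => simp [hx, hy]
  | of i D hD =>
    obtain _ | _ | i := i
    · simp [symbBracket_of_zero]
    · simp [symbBracket_of_succ, symbBracket_of_zero]
    · have h := mem_diffOp_succ.1 hD
      rw [symbBracket_of_mk b rfl hD (h b), symbBracket_of_mk a rfl hD (h a),
        symbBracket_of_mk a rfl _ (mem_diffOp_succ.1 (h b) a),
        symbBracket_of_mk b rfl _ (mem_diffOp_succ.1 (h a) b)]
      exact Symb.of_mk_eq rfl _ _ (by rw [bracket_bracket_comm, sub_self]; exact zero_mem _)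

theorem derivation_bracket (X : Derivation k R R) (a : R) :
    (X : R →ₗ[k] R) * mulOp k R a - mulOp k R a * (X : R →ₗ[k] R) = mulOp k R (X a) := by
  ext x
  simp [mul_comm x]

/-- The Leibniz rule for the bracket with a function on a product with the class of a
derivation. -/
theorem symbBracket_mul_derToSymb (a : R) (x : SymbAlg k R) (X : Derivation k R R) :
    symbBracket a (x * DirectSum.of (Symb k R) 1 (derToSymb k R X)) =
      symbBracket a x * DirectSum.of (Symb k R) 1 (derToSymb k R X) + X a • x := by
  induction x using Symb.induction_of with
  | zero => simp
  | add x y hx hy => rw [add_mul, map_add, hx, hy, map_add, add_mul, smul_add]; abel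
  | of i D hD =>
    have hX := derivation_mem X
    have e : D * (X : R →ₗ[k] R) * mulOp k R a - mulOp k R a * (D * (X : R →ₗ[k] R)) =
        (D * mulOp k R a - mulOp k R a * D) * (X : R →ₗ[k] R) + D * mulOp k R (X a) := by
      rw [← derivation_bracket]
      simp only [mul_sub, sub_mul, mul_assoc]
      abel
    have h2 : D * mulOp k R (X a) ∈ diffOp k R i := mul_mem hD (mulOp_mem' (X a))
    have h3 : DirectSum.of (Symb k R) i (Symb.mk _ h2) =
        X a • DirectSum.of (Symb k R) i (Symb.mk D hD) := by
      refine Eq.trans ?_ (Algebra.smul_def (X a) (DirectSum.of (Symb k R) i (Symb.mk D hD))).symm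
      rw [ Symb.algebraMap_eq, Symb.of_mk_mul]
      refine Symb.of_mk_eq (zero_add i).symm _ _ ?_
      exact comm_mem hD (mulOp_mem' (X a))
    rw [← h3]
    change symbBracket a (_ * DirectSum.of (Symb k R) 1 (Symb.mk _ hX)) = _
    rw [Symb.of_mk_mul]
    have h1 : D * (X : R →ₗ[k] R) * mulOp k R a - mulOp k R a * (D * (X : R →ₗ[k] R))
        ∈ diffOp k R i := mem_diffOp_succ.1 (mul_mem hD hX) a
    rw [symbBracket_of_mk a rfl _ h1]
    cases i with
    | zero =>
      rw [symbBracket_of_zero, zero_mul, zero_add]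
      refine Symb.of_mk_eq rfl _ _ ?_
      have hz : D * mulOp k R a - mulOp k R a * D = 0 :=
        mem_diffLT_succ.1 (show D ∈ diffLT k R (0 + 1) from hD) a
      rw [e, hz, zero_mul, zero_add, sub_self]
      exact zero_mem _
    | succ i =>
      have h4 := mem_diffOp_succ.1 hD a
      rw [symbBracket_of_mk a rfl hD h4]
      change _ = _ * DirectSum.of (Symb k R) 1 (Symb.mk _ hX) + _
      rw [Symb.of_mk_mul, ← map_add, Symb.mk_add]
      exact Symb.of_mk_eq rfl _ _ (by rw [e, sub_self]; exact zero_mem _)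

/-! ### Symbols in the presence of coordinates -/

/-- Elements `x j` of `R` and derivations `X j` form a *coordinate frame* if `X i (x j) = δ_ij` and
an operator of order at most `1` that commutes with all `x j` has order `0`. The second condition
replaces the requirement that the `x j` be local coordinates: it is what Hadamard's lemma gives. -/
structure IsCoordFrame {ι : Type*} [DecidableEq ι] (x : ι → R) (X : ι → Derivation k R R) :
    Prop where
  apply_coord : ∀ i j, X i (x j) = if i = j then 1 else 0
  mem_zero : ∀ D ∈ diffOp k R 1, (∀ j, D * mulOp k R (x j) - mulOp k R (x j) * D = 0) →
    D ∈ diffOp k R 0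

variable {ι : Type*} {x : ι → R} {X : ι → Derivation k R R}

/-- An operator of order `i` drops to order `i - 1` as soon as its commutators with the coordinates
drop to order `i - 2`: the commutators with arbitrary functions do so by induction. -/
theorem IsCoordFrame.mem_diffLT [DecidableEq ι] (H : IsCoordFrame x X) (i : ℕ) :
    ∀ D ∈ diffOp k R (i + 1),
      (∀ j, D * mulOp k R (x j) - mulOp k R (x j) * D ∈ diffLT k R i) → D ∈ diffOp k R i := by
  induction i with
  | zero => exact fun D hD h => H.mem_zero D hD h
  | succ i ih =>
    intro D hD h
    rw [mem_diffOp_succ]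
    intro a
    refine ih _ (mem_diffOp_succ.1 hD a) fun j => ?_
    rw [bracket_bracket_comm]
    exact mem_diffLT_succ.1 (h j) a

theorem IsCoordFrame.eq_zero_of_bracket [DecidableEq ι] (H : IsCoordFrame x X) {i : ℕ}
    (s : Symb k R (i + 1))
    (h : ∀ j, symbBracket (x j) (DirectSum.of (Symb k R) (i + 1) s) = 0) : s = 0 := by
  induction s using Symb.ind with | _ D hD
  rw [← Symb.mk_zero, Symb.mk_eq, sub_zero]
  refine H.mem_diffLT i D hD fun j => ?_
  have h1 := h j
  rw [symbBracket_of_mk _ rfl hD (mem_diffOp_succ.1 hD _)] at h1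
  have h2 := DirectSum.of_injective (β := Symb k R) i (h1.trans (map_zero _).symm)
  rw [← Symb.mk_zero, Symb.mk_eq, sub_zero] at h2
  exact h2

/-- The class of the derivation `X j` in the algebra of symbols. -/
abbrev frameSymb (X : ι → Derivation k R R) (j : ι) : SymbAlg k R :=
  DirectSum.of (Symb k R) 1 (derToSymb k R (X j))

theorem exists_of_symbBracket (a : R) {i : ℕ} (s : Symb k R i) :
    ∃ t : Symb k R (i - 1), symbBracket a (DirectSum.of (Symb k R) i s) =
      DirectSum.of (Symb k R) (i - 1) t := by
  cases i with
  | zero => exact ⟨0, by rw [symbBracket_of_zero, map_zero]⟩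
  | succ i => exact ⟨_, symbBracket_of_succ a s⟩

/-- Euler's identity for symbols of degree `i`. -/
theorem IsCoordFrame.euler [DecidableEq ι] [Fintype ι] (H : IsCoordFrame x X) (i : ℕ)
    (s : Symb k R i) :
    ∑ j, symbBracket (x j) (DirectSum.of (Symb k R) i s) * frameSymb X j =
      i • DirectSum.of (Symb k R) i s := by
  induction i with
  | zero => simp [symbBracket_of_zero]
  | succ i ih =>
    choose t ht using fun j => exists_of_symbBracket (x j) s
    have hsum : ∑ j, symbBracket (x j) (DirectSum.of (Symb k R) (i + 1) s) * frameSymb X j =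
        DirectSum.of (Symb k R) (i + 1) (∑ j, Symb.mul (t j) (derToSymb k R (X j))) := by
      rw [map_sum]
      refine Finset.sum_congr rfl fun j _ => ?_
      rw [ht]
      exact DirectSum.of_mul_of _ _
    -- Both sides have degree `i + 1` and the same brackets with the coordinates.
    rw [← sub_eq_zero, hsum, ← map_nsmul, ← map_sub]
    refine (congrArg _ (H.eq_zero_of_bracket _ fun l => ?_)).trans (map_zero _)
    rw [map_sub, ← hsum, map_sub, map_sum, map_nsmul, map_nsmul]
    have h1 : ∀ j, symbBracket (x l) (symbBracket (x j) (DirectSum.of (Symb k R) (i + 1) s)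
        * frameSymb X j) =
        symbBracket (x j) (DirectSum.of (Symb k R) i (t l)) * frameSymb X j +
          if j = l then symbBracket (x j) (DirectSum.of (Symb k R) (i + 1) s) else 0 := by
      intro j
      rw [symbBracket_mul_derToSymb, H.apply_coord, symbBracket_comm, ht l]
      split_ifs <;> simp
    rw [Finset.sum_congr rfl fun j _ => h1 j, Finset.sum_add_distrib, ih, Finset.sum_ite_eq']
    simp only [Finset.mem_univ, if_true]
    rw [show symbBracket (x l) (DirectSum.of (Symb k R) (i + 1) s) =
      DirectSum.of (Symb k R) i (t l) from ht l, succ_nsmul, sub_self]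

/-- The homomorphism from polynomials to symbols that sends the `j`-th variable to the class of the
derivation `X j`. -/
def polySymb (X : ι → Derivation k R R) : MvPolynomial ι R →ₐ[R] SymbAlg k R :=
  MvPolynomial.aeval (frameSymb X)

theorem polySymb_X (j : ι) : polySymb X (MvPolynomial.X j) = frameSymb X j :=
  MvPolynomial.aeval_X _ _

theorem IsCoordFrame.symbBracket_polySymb [DecidableEq ι] (H : IsCoordFrame x X) (j : ι)
    (P : MvPolynomial ι R) :
    symbBracket (x j) (polySymb X P) = polySymb X (MvPolynomial.pderiv j P) := by
  induction P using MvPolynomial.induction_on with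
  | C r =>
    rw [MvPolynomial.pderiv_C, map_zero, ← MvPolynomial.algebraMap_eq, AlgHom.commutes,
      symbBracket_algebraMap]
  | add P Q hP hQ => simp only [map_add, hP, hQ]
  | mul_X P l hP =>
    rw [map_mul, polySymb_X, symbBracket_mul_derToSymb, hP, H.apply_coord, Derivation.leibniz,
      MvPolynomial.pderiv_X, map_add, smul_eq_mul, smul_eq_mul, map_mul, map_mul, polySymb_X]
    by_cases h : l = j
    · subst h
      simp
      ring
    · rw [if_neg h, Pi.single_eq_of_ne (Ne.symm (Ne.symm h))]
      simp
      ring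

theorem exists_eq_add_single {N : ℕ} {m : ι →₀ ℕ} (hm : m.degree = N + 1) :
    ∃ (m' : ι →₀ ℕ) (j : ι), m'.degree = N ∧ m = m' + Finsupp.single j 1 := by
  obtain ⟨j, hj⟩ : ∃ j, m j ≠ 0 := by
    by_contra! h
    have h0 : m = 0 := Finsupp.ext h
    simp [h0] at hm
  have e : m - Finsupp.single j 1 + Finsupp.single j 1 = m :=
    Finsupp.sub_add_single_one_cancel hj
  refine ⟨m - Finsupp.single j 1, j, ?_, e.symm⟩
  have h2 := congrArg Finsupp.degree e
  rw [map_add, Finsupp.degree_single, hm] at h2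
  omega

/-- Monomials of degree `i` have symbols of degree `i`. -/
theorem exists_of_polySymb_monomial (X : ι → Derivation k R R) (N : ℕ) (r : R) :
    ∀ m : ι →₀ ℕ, m.degree = N → ∃ s : Symb k R N,
      polySymb X (MvPolynomial.monomial m r) = DirectSum.of (Symb k R) N s := by
  induction N with
  | zero =>
    intro m hm
    rw [Finsupp.degree_eq_zero_iff] at hm
    subst hm
    exact ⟨Symb.mk (mulOp k R r) (mulOp_mem' r), (polySymb X).commutes r⟩
  | succ N ih =>
    intro m hm
    obtain ⟨m', j, hm', rfl⟩ := exists_eq_add_single hm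
    obtain ⟨s, hs⟩ := ih m' hm'
    rw [MvPolynomial.monomial_add_single, pow_one, map_mul, hs, polySymb_X]
    exact ⟨_, DirectSum.of_mul_of _ _⟩

theorem polySymb_equivMvPolynomial {M : Type*} [AddCommGroup M] [Module R M]
    {ℓ : M →ₗ[R] Derivation k R R} (b : Module.Basis ι R M) (y : SymmetricAlgebra R M) :
    polySymb (fun j => ℓ (b j)) (SymmetricAlgebra.equivMvPolynomial b y) = symbolHom ℓ y := by
  have h : ((polySymb (fun j => ℓ (b j))).comp
      (SymmetricAlgebra.equivMvPolynomial b).toAlgHom) = symbolHom ℓ := by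
    refine SymmetricAlgebra.algHom_ext (b.ext fun j => ?_)
    change polySymb _ (SymmetricAlgebra.equivMvPolynomial b (SymmetricAlgebra.ι R M (b j))) =
      symbolHom ℓ (SymmetricAlgebra.ι R M (b j))
    rw [SymmetricAlgebra.equivMvPolynomial_ι_apply, polySymb_X, symbolHom_ι]
  exact AlgHom.congr_fun h y

/-- The class in `Symb^i(R)` of a monomial of degree `i` in the derivations `X j`. -/
def monomialSymb (X : ι → Derivation k R R) (i : ℕ) (m : {m : ι →₀ ℕ // m.degree = i}) :
    Symb k R i :=
  polySymb X (MvPolynomial.monomial m.1 1) i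

theorem of_monomialSymb (X : ι → Derivation k R R) (i : ℕ) (m : {m : ι →₀ ℕ // m.degree = i}) :
    DirectSum.of (Symb k R) i (monomialSymb X i m) =
      polySymb X (MvPolynomial.monomial m.1 1) := by
  obtain ⟨s, hs⟩ := exists_of_polySymb_monomial X i 1 m.1 m.2
  rw [monomialSymb, hs, DirectSum.of_eq_same]

end Algebra

section Field

variable {k R : Type*} [Field k] [CharZero k] [CommRing R] [Algebra k R]
  {ι : Type*} {x : ι → R} {X : ι → Derivation k R R}

theorem eq_zero_of_succ_mul (k : Type*) {R : Type*} [Field k] [CharZero k] [CommRing R]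
    [Algebra k R] {m : ℕ} {r : R} (h : r * (m + 1) = 0) : r = 0 := by
  have h1 : ((m : R) + 1) = algebraMap k R (m + 1) := by simp
  have h2 : ((m : k) + 1) ≠ 0 := by exact_mod_cast Nat.succ_ne_zero m
  have h3 : algebraMap k R (m + 1) * algebraMap k R (m + 1)⁻¹ = 1 := by
    rw [← map_mul, mul_inv_cancel₀ h2, map_one]
  calc r = r * (algebraMap k R (m + 1) * algebraMap k R (m + 1)⁻¹) := by rw [h3, mul_one]
    _ = 0 := by rw [← mul_assoc, ← h1, h, zero_mul]

/-- A polynomial with symbol zero vanishes: its coefficients are recovered, up to nonzero integers,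
by bracketing repeatedly with the coordinates. -/
theorem IsCoordFrame.polySymb_injective [DecidableEq ι] (H : IsCoordFrame x X) :
    Function.Injective (polySymb X) := by
  have key : ∀ (N : ℕ) (m : ι →₀ ℕ), m.degree = N → ∀ P : MvPolynomial ι R,
      polySymb X P = 0 → P.coeff m = 0 := by
    intro N
    induction N with
    | zero =>
      intro m hm P hP
      rw [Finsupp.degree_eq_zero_iff] at hm
      subst hm
      -- In degree `0`, the symbol of a polynomial is multiplication by its constant coefficient.
      have h1 : ∀ Q : MvPolynomial ι R,
          polySymb X Q 0 = Symb.mk (mulOp k R (Q.coeff 0)) (mulOp_mem' _) := by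
        intro Q
        induction Q using MvPolynomial.induction_on' with
        | monomial m r =>
          by_cases h0 : m = 0
          · subst h0
            rw [MvPolynomial.coeff_monomial, if_pos rfl]
            have e : polySymb X (MvPolynomial.monomial 0 r) = DirectSum.of (Symb k R) 0
              (Symb.mk (mulOp k R r) (mulOp_mem' r)) := (polySymb X).commutes r
            rw [e]
            exact DirectSum.of_eq_same _ _
          · obtain ⟨s, hs⟩ := exists_of_polySymb_monomial X _ r m rfl
            rw [hs, MvPolynomial.coeff_monomial, if_neg h0, DirectSum.of_eq_of_ne _ _ _
              (fun h => h0 ((Finsupp.degree_eq_zero_iff m).1 h.symm))]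
            rw [← Symb.mk_zero, Symb.mk_eq]
            simp [mulOp]
        | add P Q hP hQ =>
          rw [map_add, DirectSum.add_apply, hP, hQ, Symb.mk_add, Symb.mk_eq, MvPolynomial.coeff_add]
          have h : mulOp k R (P.coeff 0) + mulOp k R (Q.coeff 0)
              - mulOp k R (P.coeff 0 + Q.coeff 0) = 0 := by
            ext x
            simp [add_mul]
          rw [h]
          exact zero_mem _
      have h2 := h1 P
      rw [hP, DirectSum.zero_apply, ← Symb.mk_zero, Symb.mk_eq] at h2
      have h3 : (0 : Module.End k R) - mulOp k R (P.coeff 0) = 0 := h2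
      simpa using LinearMap.congr_fun h3 1
    | succ N ih =>
      intro m hm P hP
      obtain ⟨m', j, hm', rfl⟩ := exists_eq_add_single hm
      have h1 := ih m' hm' (MvPolynomial.pderiv j P) (by
        rw [← H.symbBracket_polySymb, hP, map_zero])
      rw [MvPolynomial.coeff_pderiv] at h1
      exact eq_zero_of_succ_mul k h1
  refine (injective_iff_map_eq_zero _).2 fun P hP => ?_
  ext m
  exact key _ m rfl P hP

variable {M : Type*} [AddCommGroup M] [Module R M] {ℓ : M →ₗ[R] Derivation k R R}

/-- Every symbol of positive degree `i` is the sum of the products `X j * s j / i`, where `s j` is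
its bracket with the `j`-th coordinate, so symbols are polynomials in the frame. -/
theorem IsCoordFrame.exists_symDeg [DecidableEq ι] [Fintype ι] {b : ι → M}
    (H : IsCoordFrame x fun j => ℓ (b j)) (i : ℕ) (s : Symb k R i) :
    ∃ y ∈ symDeg R M i, symbolHom ℓ y = DirectSum.of (Symb k R) i s := by
  induction i with
  | zero =>
    induction s using Symb.ind with | _ D hD
    refine ⟨algebraMap R _ (D 1), ?_, ?_⟩
    · rw [symDeg, pow_zero]
      exact Submodule.mem_one.2 ⟨_, rfl⟩
    · rw [AlgHom.commutes, Symb.algebraMap_eq]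
      exact Symb.of_mk_eq rfl _ _ (by rw [← eq_mulOp hD, sub_self]; exact zero_mem _)
  | succ i ih =>
    have hc : ((i : k) + 1) ≠ 0 := by exact_mod_cast Nat.succ_ne_zero i
    choose t ht using fun j => exists_of_symbBracket (x j) s
    choose y hy hyt using fun j => ih (t j)
    refine ⟨algebraMap k R ((i + 1 : k)⁻¹) • ∑ j, y j * SymmetricAlgebra.ι R M (b j), ?_, ?_⟩
    · refine Submodule.smul_mem _ _ (Submodule.sum_mem _ fun j _ => ?_)
      rw [symDeg, pow_succ]
      exact Submodule.mul_mem_mul (hy j) ⟨b j, rfl⟩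
    · have h1 := H.euler (i + 1) s
      have h2 : symbolHom ℓ (∑ j, y j * SymmetricAlgebra.ι R M (b j)) =
          (i + 1) • DirectSum.of (Symb k R) (i + 1) s := by
        rw [← h1, map_sum]
        refine Finset.sum_congr rfl fun j _ => ?_
        rw [map_mul, hyt, symbolHom_ι, ht]
        rfl
      rw [map_smul, h2, ← Nat.cast_smul_eq_nsmul R, smul_smul]
      have h3 : algebraMap k R ((i + 1 : k)⁻¹) * ((i + 1 : ℕ) : R) = 1 := by
        rw [← map_natCast (algebraMap k R), ← map_mul, Nat.cast_succ, inv_mul_cancel₀ hc, map_one]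
      rw [h3, one_smul]

variable [Fintype ι] (b : Module.Basis ι R M)

theorem IsCoordFrame.symbolHom_bijective [DecidableEq ι] (H : IsCoordFrame x fun j => ℓ (b j)) :
    Function.Bijective (symbolHom ℓ) := by
  constructor
  · intro y z h
    rw [← polySymb_equivMvPolynomial b, ← polySymb_equivMvPolynomial b] at h
    exact (SymmetricAlgebra.equivMvPolynomial b).injective (H.polySymb_injective h)
  · intro s
    induction s using DirectSum.induction_on with
    | zero => exact ⟨0, map_zero _⟩
    | of i s =>
      obtain ⟨y, -, hy⟩ := H.exists_symDeg i s
      exact ⟨y, hy⟩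
    | add s t hs ht =>
      obtain ⟨y, rfl⟩ := hs
      obtain ⟨z, rfl⟩ := ht
      exact ⟨y + z, map_add _ _ _⟩

theorem IsCoordFrame.symbolHomDeg_bijective [DecidableEq ι] (H : IsCoordFrame x fun j => ℓ (b j))
    (i : ℕ) : Function.Bijective (symbolHomDeg ℓ i) := by
  constructor
  · intro y z h
    refine Subtype.ext ((H.symbolHom_bijective b).1 ?_)
    rw [← of_symbolHomDeg, ← of_symbolHomDeg, h]
  · intro s
    obtain ⟨y, hy, hys⟩ := H.exists_symDeg i s
    refine ⟨⟨y, hy⟩, DirectSum.of_injective (β := Symb k R) i ?_⟩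
    rw [of_symbolHomDeg]
    exact hys

/-- In the presence of a coordinate frame, the algebra of symbols is a polynomial ring. -/
def IsCoordFrame.polyEquiv [DecidableEq ι] (H : IsCoordFrame x fun j => ℓ (b j)) :
    MvPolynomial ι R ≃ₐ[R] SymbAlg k R :=
  AlgEquiv.ofBijective (polySymb fun j => ℓ (b j)) ⟨H.polySymb_injective, fun s => by
    obtain ⟨y, hy⟩ := (H.symbolHom_bijective b).2 s
    exact ⟨SymmetricAlgebra.equivMvPolynomial b y, by rw [polySymb_equivMvPolynomial, hy]⟩⟩

/-- The monomials in the frame are a basis of the algebra of symbols. -/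
def IsCoordFrame.basis [DecidableEq ι] (H : IsCoordFrame x fun j => ℓ (b j)) :
    Module.Basis (ι →₀ ℕ) R (SymbAlg k R) :=
  (MvPolynomial.basisMonomials ι R).map (H.polyEquiv b).toLinearEquiv

theorem IsCoordFrame.basis_apply [DecidableEq ι] (H : IsCoordFrame x fun j => ℓ (b j))
    (m : ι →₀ ℕ) : H.basis b m = polySymb (fun j => ℓ (b j)) (MvPolynomial.monomial m 1) := by
  rw [IsCoordFrame.basis, Module.Basis.map_apply, MvPolynomial.coe_basisMonomials]
  rfl

/-- The monomials of degree `i` in the frame are a basis of the symbols of degree `i`. -/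
theorem IsCoordFrame.exists_basisDeg [DecidableEq ι] (H : IsCoordFrame x fun j => ℓ (b j))
    (i : ℕ) : ∃ e : Module.Basis {m : ι →₀ ℕ // m.degree = i} R (Symb k R i),
      ∀ m, e m = monomialSymb (fun j => ℓ (b j)) i m := by
  have hof : ∀ m, DirectSum.lof R ℕ (Symb k R) i (monomialSymb (fun j => ℓ (b j)) i m) =
      H.basis b m.1 := fun m => (of_monomialSymb _ i m).trans (H.basis_apply b m.1).symm
  refine ⟨Module.Basis.mk (v := monomialSymb (fun j => ℓ (b j)) i) ?_ ?_, fun m =>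
    Module.Basis.mk_apply _ _ m⟩
  · refine LinearIndependent.of_comp (DirectSum.lof R ℕ (Symb k R) i) ?_
    have e : (DirectSum.lof R ℕ (Symb k R) i ∘ monomialSymb (fun j => ℓ (b j)) i) =
      H.basis b ∘ Subtype.val := funext hof
    rw [e]
    exact (H.basis b).linearIndependent.comp _ Subtype.val_injective
  · rintro s -
    have h1 : s = DirectSum.component R ℕ (Symb k R) i (DirectSum.lof R ℕ (Symb k R) i s) :=
      (DirectSum.component.lof_self R i s).symm
    rw [h1, ← (H.basis b).linearCombination_repr (DirectSum.lof R ℕ (Symb k R) i s),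
      Finsupp.linearCombination_apply, Finsupp.sum, map_sum]
    refine Submodule.sum_mem _ fun m _ => ?_
    rw [map_smul]
    refine Submodule.smul_mem _ _ ?_
    by_cases hm : m.degree = i
    · rw [← hof ⟨m, hm⟩, DirectSum.component.lof_self]
      exact Submodule.subset_span ⟨_, rfl⟩
    · obtain ⟨t, ht⟩ := exists_of_polySymb_monomial (fun j => ℓ (b j)) _ 1 m rfl
      rw [H.basis_apply, ht]
      change (DirectSum.of (Symb k R) m.degree t : SymbAlg k R) i ∈ _
      rw [DirectSum.of_eq_of_ne _ _ _ (Ne.symm hm)]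
      exact zero_mem _

end Field

end DiffOps

/-! ### Local freeness of associated sheaves of modules -/

namespace SheafOfModules

universe v₁ u₁

variable {C : Type u₁} [Category.{v₁} C] {J : GrothendieckTopology C} {R : Sheaf J RingCat.{u}}

/-- Morphisms out of a presheaf of modules with a compatible family of bases are given by
the images of the basis sections. -/
theorem bijective_sectionsMap_of_basis {P N : PresheafOfModules.{u} R.obj} {I : Type u}
    (e : I → P.sections) (b : ∀ X, Module.Basis I (R.obj.obj X) (P.obj X))
    (hb : ∀ X i, b X i = (e i).eval X) :
    Function.Bijective fun (h : P ⟶ N) (i : I) => PresheafOfModules.sectionsMap h (e i) := by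
  constructor
  · intro g h hgh
    refine PresheafOfModules.hom_ext fun X => ModuleCat.hom_ext ((b X).ext fun i => ?_)
    have h1 := congrArg (fun s : N.sections => s.eval X) (congrFun hgh i)
    rw [hb]
    exact h1
  · intro t
    have hc : ∀ X i, ((b X).constr ℕ fun i => (t i).eval X) ((e i).eval X) = (t i).eval X := by
      intro X i
      rw [← hb, Module.Basis.constr_basis]
    refine ⟨{ app := fun X => ModuleCat.ofHom ((b X).constr ℕ fun i => (t i).eval X)
              naturality := fun {X Y} g => ?_ }, ?_⟩
    · refine ModuleCat.hom_ext ((b X).ext fun i => ?_)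
      rw [hb]
      change ((b Y).constr ℕ fun i => (t i).eval Y) (P.map g ((e i).eval X)) =
        N.map g (((b X).constr ℕ fun i => (t i).eval X) ((e i).eval X))
      rw [hc]
      erw [PresheafOfModules.sections_property (e i) g]
      rw [hc, PresheafOfModules.sections_property]
    · funext i
      refine PresheafOfModules.sections_ext _ _ fun X => ?_
      exact hc X i

/-- If a sheaf of modules `F` is associated with a presheaf that has a compatible family of bases,
then the basis sections identify `F` with a free sheaf. -/
theorem isIso_freeHomEquiv_symm_of_basis [HasWeakSheafify J AddCommGrpCat.{u}]
    [J.WEqualsLocallyBijective AddCommGrpCat.{u}] {F : SheafOfModules.{u} R}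
    {P : PresheafOfModules.{u} R.obj} (f : P ⟶ F.val)
    [PresheafOfModules.IsLocallyInjective J f] [PresheafOfModules.IsLocallySurjective J f]
    {I : Type u} (e : I → P.sections) (b : ∀ X, Module.Basis I (R.obj.obj X) (P.obj X))
    (hb : ∀ X i, b X i = (e i).eval X) :
    IsIso (F.freeHomEquiv.symm fun i => PresheafOfModules.sectionsMap f (e i)) := by
  refine (isIso_iff_coyoneda_map_bijective _).2 fun N => ?_
  have h1 : Function.Bijective fun g : F ⟶ N => g.val :=
    (fullyFaithfulForget R).homEquiv.bijective
  have h2 := (PresheafOfModules.homEquivOfIsLocallyBijective f N.isSheaf).bijective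
  have h3 := bijective_sectionsMap_of_basis (N := N.val) e b hb
  have h4 := (N.freeHomEquiv (I := I)).symm.bijective
  convert h4.comp (h3.comp (h2.comp h1)) using 1
  funext g
  exact freeHomEquiv_symm_comp _ _

section

variable [∀ X, HasWeakSheafify (J.over X) AddCommGrpCat.{u}]
  [∀ X, (J.over X).WEqualsLocallyBijective AddCommGrpCat.{u}]

/-- A sheaf of modules is locally free if it is associated with a presheaf of modules that has
compatible families of bases over the members of a covering. -/
theorem isLocallyFree_of_basis {F : SheafOfModules.{u} R}
    {P : PresheafOfModules.{u} R.obj} (f : P ⟶ F.val)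
    [PresheafOfModules.IsLocallyInjective J f] [PresheafOfModules.IsLocallySurjective J f]
    {K : Type u₁} {X : K → C} (hX : J.CoversTop X) {I : Type u}
    (b : ∀ (k : K) (Y : Over (X k)), Module.Basis I (R.obj.obj (op Y.left)) (P.obj (op Y.left)))
    (hb : ∀ (k : K) {Y Z : Over (X k)} (g : Y ⟶ Z) (i : I),
      P.map g.left.op (b k Z i) = b k Y i) :
    F.IsLocallyFree := by
  let res (k : K) := PresheafOfModules.pushforward.{u} (𝟙 (R.over (X k)) :).hom
  let fk (k : K) : (res k).obj P ⟶ (F.over (X k)).val := (res k).map f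
  have hinj (k : K) : PresheafOfModules.IsLocallyInjective (J.over (X k)) (fk k) :=
    Presheaf.isLocallyInjective_whisker (J := J.over (X k)) (K := J) (Over.forget (X k))
      ((PresheafOfModules.toPresheaf _).map f)
  have hsurj (k : K) : PresheafOfModules.IsLocallySurjective (J.over (X k)) (fk k) :=
    Presheaf.isLocallySurjective_whisker (J := J.over (X k)) (K := J) (Over.forget (X k))
      ((PresheafOfModules.toPresheaf _).map f)
  let e (k : K) (i : I) : ((res k).obj P).sections :=
    PresheafOfModules.sectionsMk (fun Y => b k Y.unop i) (fun Y Z g => hb k g.unop i)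
  have hiso (k : K) := isIso_freeHomEquiv_symm_of_basis (fk k) (e k)
    (fun Y => b k Y.unop) (fun Y i => rfl)
  let q : F.LocalGeneratorsData :=
    { I := K
      X := X
      coversTop := hX
      generators := fun k =>
        { I := I
          s := fun i => PresheafOfModules.sectionsMap (fk k) (e k i)
          epi := by
            have := hiso k
            infer_instance } }
  have : q.IsLocallyFreeData := ⟨hiso⟩
  exact q.isLocallyFree

end

end SheafOfModules

/-! ### Coordinate frames from charts -/

namespace DiffOps

section Hadamard

open MeasureTheory

/-- Smoothness of an integral over `[0, 1]` depending smoothly on a parameter. The integral is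
the value at `0` of a convolution with the indicator function of `(0, 1]`. -/
theorem contDiff_parametric_integral {P V : Type*} [NormedAddCommGroup P] [NormedSpace ℝ P]
    [NormedAddCommGroup V] [NormedSpace ℝ V] {H : P → ℝ → V}
    (hH : ContDiff ℝ ∞ fun q : P × ℝ => H q.1 q.2) :
    ContDiff ℝ ∞ fun y => ∫ t in (0 : ℝ)..1, H y t := by
  let ρ : ContDiffBump (0 : ℝ) := ⟨2, 3, by norm_num, by norm_num⟩
  let g : P → ℝ → V := fun y s => ρ s • H y (-s)
  let f : ℝ → ℝ := (Set.Ioc 0 1).indicator fun _ => 1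
  have hg : ContDiff ℝ ∞ fun q : P × ℝ => g q.1 q.2 :=
    (ρ.contDiff.comp contDiff_snd).smul (hH.comp (contDiff_fst.prodMk contDiff_snd.neg))
  have hf : LocallyIntegrable f volume :=
    ((integrableOn_const (by simp)).integrable_indicator measurableSet_Ioc).locallyIntegrable
  have key := contDiffOn_convolution_right_with_param_comp (n := ⊤) (μ := volume)
    (ContinuousLinearMap.lsmul ℝ ℝ) (v := fun _ : P => (0 : ℝ)) (s := Set.univ) (f := f) (g := g)
    contDiffOn_const isOpen_univ (isCompact_closedBall (0 : ℝ) 3)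
    (fun y s _ hs => by
      have : ρ s = 0 := ρ.zero_of_le_dist (by
        rw [Metric.mem_closedBall, not_le] at hs
        exact hs.le)
      simp [g, this]) hf hg.contDiffOn
  rw [contDiffOn_univ] at key
  convert! key using 1
  funext y
  rw [intervalIntegral.integral_of_le zero_le_one, ← integral_indicator measurableSet_Ioc]
  refine integral_congr_ae (Filter.Eventually.of_forall fun t => ?_)
  by_cases ht : t ∈ Set.Ioc (0 : ℝ) 1
  · have h1 : ρ (-t) = 1 := ρ.one_of_mem_closedBall (by
      rw [Metric.mem_closedBall, dist_zero_right, norm_neg, Real.norm_eq_abs, abs_of_pos ht.1]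
      exact ht.2.trans (by norm_num))
    simp [f, g, ht, h1]
  · simp [f, ht]

/-- Hadamard's lemma. -/
theorem hadamard {n : ℕ} {F : EuclideanSpace ℝ (Fin n) → ℝ} (hF : ContDiff ℝ ∞ F)
    (p : EuclideanSpace ℝ (Fin n)) :
    ∃ G : Fin n → EuclideanSpace ℝ (Fin n) → ℝ, (∀ j, ContDiff ℝ ∞ (G j)) ∧
      ∀ y, F y = F p + ∑ j, (y j - p j) * G j y := by
  have hF' : ContDiff ℝ ∞ (fderiv ℝ F) := hF.fderiv_right (by simp)
  have hA : ContDiff ℝ ∞ fun y => ∫ t in (0 : ℝ)..1, fderiv ℝ F (p + t • (y - p)) :=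
    contDiff_parametric_integral (H := fun y t => fderiv ℝ F (p + t • (y - p)))
      (hF'.comp (by fun_prop))
  refine ⟨fun j y => (∫ t in (0 : ℝ)..1, fderiv ℝ F (p + t • (y - p)))
    (EuclideanSpace.single j 1), fun j => hA.clm_apply contDiff_const, fun y => ?_⟩
  have hcont : Continuous fun t : ℝ => fderiv ℝ F (p + t • (y - p)) :=
    hF'.continuous.comp (by fun_prop)
  have h1 : ∫ t in (0 : ℝ)..1, fderiv ℝ F (p + t • (y - p)) (y - p) = F y - F p := by
    have h := intervalIntegral.integral_eq_sub_of_hasDerivAt (a := 0) (b := 1)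
      (f := fun t : ℝ => F (p + t • (y - p)))
      (f' := fun t => fderiv ℝ F (p + t • (y - p)) (y - p)) (fun t _ => ?_)
      ((hcont.clm_apply continuous_const).intervalIntegrable _ _)
    · rw [h]
      simp
    · have hd : HasDerivAt (fun t : ℝ => p + t • (y - p)) (y - p) t := by
        simpa using ((hasDerivAt_id t).smul_const (y - p)).const_add p
      exact ((hF.differentiable (by simp)) _).hasFDerivAt.comp_hasDerivAt t hd
  rw [← ContinuousLinearMap.intervalIntegral_apply (hcont.intervalIntegrable _ _)] at h1
  set A := ∫ t in (0 : ℝ)..1, fderiv ℝ F (p + t • (y - p))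
  have h2 : y - p = ∑ j, (y j - p j) • EuclideanSpace.single j (1 : ℝ) := by
    simpa using ((EuclideanSpace.basisFun (Fin n) ℝ).sum_repr (y - p)).symm
  rw [← sub_eq_iff_eq_add', ← h1, h2, map_sum]
  exact Finset.sum_congr rfl fun j _ => map_smul A _ _

/-- A function that is smooth near a point agrees near this point with a globally smooth one. -/
theorem exists_contDiff_eventuallyEq {E : Type*} [NormedAddCommGroup E] [InnerProductSpace ℝ E]
    [FiniteDimensional ℝ E] {h : E → ℝ} {q : E} (hh : ∀ᶠ z in nhds q, ContDiffAt ℝ ∞ h z) :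
    ∃ F : E → ℝ, ContDiff ℝ ∞ F ∧ ∀ᶠ z in nhds q, F z = h z := by
  obtain ⟨ε, hε, hb⟩ := Metric.eventually_nhds_iff_ball.1 hh
  let χ : ContDiffBump q := ⟨ε / 3, ε / 2, by positivity, by linarith⟩
  refine ⟨fun z => χ z * h z, contDiff_iff_contDiffAt.2 fun z => ?_, ?_⟩
  · by_cases hz : z ∈ Metric.ball q ε
    · exact χ.contDiff.contDiffAt.mul (hb z hz)
    · have hz' : z ∈ (Metric.closedBall q (ε / 2))ᶜ := fun h =>
        hz (Metric.closedBall_subset_ball (by linarith) h)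
      refine contDiffAt_const (c := (0 : ℝ)) |>.congr_of_eventuallyEq ?_
      filter_upwards [Metric.isClosed_closedBall.isOpen_compl.mem_nhds hz'] with w hw
      have h0 : χ w = 0 := χ.zero_of_le_dist (by
        rw [Set.mem_compl_iff, Metric.mem_closedBall, not_le] at hw
        exact hw.le)
      rw [h0, zero_mul]
  · filter_upwards [χ.eventuallyEq_one] with z hz
    rw [hz, Pi.one_apply, one_mul]

end Hadamard

section ChartFrame

variable {n : ℕ} {M : Type u} [TopologicalSpace M] [ChartedSpace (EuclideanSpace ℝ (Fin n)) M]
  {x₀ : M} {V : Opens M}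

variable (n) in
/-- The chart at `x₀` as a map on an open subset `V`; it is used for `V` inside the domain of the
chart. -/
def chartMap (x₀ : M) (V : Opens M) : V → EuclideanSpace ℝ (Fin n) :=
  fun y => chartAt (EuclideanSpace ℝ (Fin n)) x₀ y.1

variable (n) in
/-- The domain of the chart at `x₀`. -/
def chartDom (x₀ : M) : Opens M :=
  ⟨(chartAt (EuclideanSpace ℝ (Fin n)) x₀).source, (chartAt _ x₀).open_source⟩

variable [IsManifold (𝓡 n) ∞ M]

theorem contMDiff_chartMap (hV : V ≤ chartDom n x₀) :
    ContMDiff (𝓡 n) (𝓡 n) ∞ (chartMap n x₀ V) := by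
  intro y
  have h1 : ContMDiffAt (𝓡 n) (𝓡 n) ∞ (chartAt (EuclideanSpace ℝ (Fin n)) x₀) y.1 :=
    (contMDiffOn_chart (I := 𝓡 n) (n := ∞) (x := x₀)).contMDiffAt
      ((chartAt _ x₀).open_source.mem_nhds (hV y.2))
  exact contMDiffAt_subtype_iff.2 h1

/-- On `V`, the chart has a smooth local inverse at each point. -/
theorem exists_chartMap_inverse (hV : V ≤ chartDom n x₀) (y : V) :
    ∃ r : EuclideanSpace ℝ (Fin n) → V, (∀ z, r (chartMap n x₀ V z) = z) ∧
      (∀ᶠ z in nhds (chartMap n x₀ V y), chartMap n x₀ V (r z) = z) ∧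
      ∀ z : V, ContMDiffAt (𝓡 n) (𝓡 n) ∞ r (chartMap n x₀ V z) := by
  classical
  set φ := chartAt (EuclideanSpace ℝ (Fin n)) x₀
  -- The inverse of the chart, with the junk value `y` where it leaves `V`.
  let r : EuclideanSpace ℝ (Fin n) → V := fun z =>
    if hz : φ.symm z ∈ V then ⟨φ.symm z, hz⟩ else y
  have hl : ∀ z : V, φ.symm (chartMap n x₀ V z) = z := fun z => φ.left_inv (hV z.2)
  have hev : ∀ z : V, ∀ᶠ w in nhds (chartMap n x₀ V z), w ∈ φ.target ∧ φ.symm w ∈ V := by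
    intro z
    have h1 : chartMap n x₀ V z ∈ φ.target := φ.map_source (hV z.2)
    filter_upwards [φ.open_target.mem_nhds h1, (φ.continuousAt_symm h1).preimage_mem_nhds
      (V.isOpen.mem_nhds (show φ.symm (chartMap n x₀ V z) ∈ V by rw [hl]; exact z.2))]
      with w hw hw' using ⟨hw, hw'⟩
  have hr : ∀ w, φ.symm w ∈ V → (r w : M) = φ.symm w := fun w hw => by
    simp only [r, dif_pos hw]
  refine ⟨r, fun z => Subtype.ext ?_, ?_, fun z => ?_⟩
  · rw [hr _ (by rw [hl]; exact z.2), hl]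
  · filter_upwards [hev y] with w hw
    change φ (r w : M) = w
    rw [hr w hw.2, φ.right_inv hw.1]
  · rw [← ContMDiffAt.subtypeVal_comp_iff]
    have h1 : ContMDiffAt (𝓡 n) (𝓡 n) ∞ φ.symm (chartMap n x₀ V z) :=
      (contMDiffOn_chart_symm (I := 𝓡 n) (n := ∞) (x := x₀)).contMDiffAt
        (φ.open_target.mem_nhds (φ.map_source (hV z.2)))
    refine h1.congr_of_eventuallyEq ?_
    filter_upwards [hev z] with w hw using hr w hw.2

theorem mfderiv_chartMap_isInvertible (hV : V ≤ chartDom n x₀) (y : V) :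
    (mfderiv (𝓡 n) (𝓡 n) (chartMap n x₀ V) y).IsInvertible := by
  obtain ⟨r, hr, hev, hrs⟩ := exists_chartMap_inverse hV y
  have hrd := ((hrs y).mdifferentiableAt (by simp)).hasMFDerivAt
  have hcd := ((contMDiff_chartMap hV y).mdifferentiableAt (by simp)).hasMFDerivAt
  set A : EuclideanSpace ℝ (Fin n) →L[ℝ] EuclideanSpace ℝ (Fin n) :=
    mfderiv (𝓡 n) (𝓡 n) (chartMap n x₀ V) y
  set B : EuclideanSpace ℝ (Fin n) →L[ℝ] EuclideanSpace ℝ (Fin n) :=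
    mfderiv (𝓡 n) (𝓡 n) r (chartMap n x₀ V y)
  have h1 : B.comp A = ContinuousLinearMap.id ℝ _ := by
    have e1 : HasMFDerivAt (𝓡 n) (𝓡 n) (r ∘ chartMap n x₀ V) y (B.comp A) :=
      HasMFDerivAt.comp y hrd hcd
    have e2 : r ∘ chartMap n x₀ V = id := funext hr
    rw [e2] at e1
    exact hasMFDerivAt_unique e1 (hasMFDerivAt_id y)
  have h2 : A.comp B = ContinuousLinearMap.id ℝ _ := by
    have e0 : ∀ z, z = y → HasMFDerivAt (𝓡 n) (𝓡 n) (chartMap n x₀ V) z A := by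
      rintro z rfl
      exact hcd
    have e1 : HasMFDerivAt (𝓡 n) (𝓡 n) (chartMap n x₀ V ∘ r) (chartMap n x₀ V y) (A.comp B) :=
      HasMFDerivAt.comp (chartMap n x₀ V y) (e0 _ (hr y)) hrd
    exact hasMFDerivAt_unique (e1.congr_of_eventuallyEq (hev.mono fun z hz => hz.symm))
      (hasMFDerivAt_id _)
  exact ContinuousLinearMap.IsInvertible.of_inverse h2 h1

/-- The coordinate functions of the chart at `x₀`, on `V`. -/
def chartCoord (hV : V ≤ chartDom n x₀) (j : Fin n) : Smooth n V :=
  ⟨fun y => chartMap n x₀ V y j,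
    (EuclideanSpace.proj (𝕜 := ℝ) j).contMDiff.comp (contMDiff_chartMap hV)⟩

/-- The coordinate vector fields of the chart at `x₀`, on `V`. -/
def chartFrame (hV : V ≤ chartDom n x₀) (j : Fin n) : VecField n V :=
  ⟨VectorField.mpullback (𝓡 n) (𝓡 n) (chartMap n x₀ V)
      fun _ => (EuclideanSpace.single j 1 : EuclideanSpace ℝ (Fin n)),
    ContMDiff.mpullback_vectorField (n := ∞)
      (contMDiff_vectorSpace_iff_contDiff.2 contDiff_const)
      (contMDiff_chartMap hV) (mfderiv_chartMap_isInvertible hV) (by simp)⟩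

theorem mfderiv_chartFrame (hV : V ≤ chartDom n x₀) (j : Fin n) (y : V) :
    mfderiv (𝓡 n) (𝓡 n) (chartMap n x₀ V) y (chartFrame hV j y) =
      (EuclideanSpace.single j 1 : EuclideanSpace ℝ (Fin n)) :=
  (mfderiv_chartMap_isInvertible hV y).self_apply_inverse _

theorem lieDer_chartCoord (hV : V ≤ chartDom n x₀) (X : VecField n V) (j : Fin n) (y : V) :
    lieDer V X (chartCoord hV j) y =
      WithLp.ofLp (p := 2) (V := Fin n → ℝ)
        (mfderiv (𝓡 n) (𝓡 n) (chartMap n x₀ V) y (X y)) j := by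
  have hcd := ((contMDiff_chartMap hV y).mdifferentiableAt (by simp)).hasMFDerivAt
  have e : HasMFDerivAt (𝓡 n) 𝓘(ℝ, ℝ) (chartCoord hV j) y
      ((EuclideanSpace.proj (𝕜 := ℝ) j : EuclideanSpace ℝ (Fin n) →L[ℝ] ℝ).comp
        (mfderiv (𝓡 n) (𝓡 n) (chartMap n x₀ V) y)) :=
    HasMFDerivAt.comp (f := chartMap n x₀ V) y
      (EuclideanSpace.proj (𝕜 := ℝ) j : EuclideanSpace ℝ (Fin n) →L[ℝ] ℝ).hasMFDerivAt hcd
  rw [lieDer_apply, e.mfderiv]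
  rfl

theorem lieDer_chartFrame_chartCoord (hV : V ≤ chartDom n x₀) (i j : Fin n) :
    lieDer V (chartFrame hV i) (chartCoord hV j) = if i = j then 1 else 0 := by
  ext y
  rw [lieDer_chartCoord, mfderiv_chartFrame]
  by_cases h : i = j
  · subst h
    simp
  · simp [h]

/-- A vector field on `V` is determined by the derivatives of the coordinates. -/
theorem vecField_ext_chartCoord (hV : V ≤ chartDom n x₀) {X Y : VecField n V}
    (h : ∀ j, lieDer V X (chartCoord hV j) = lieDer V Y (chartCoord hV j)) : X = Y := by
  ext y
  refine (mfderiv_chartMap_isInvertible hV y).injective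
    (WithLp.ofLp_injective 2 (funext fun j => ?_))
  have h1 := congrArg (fun f : Smooth n V => f y) (h j)
  simp only [lieDer_chartCoord] at h1
  exact h1

/-- The family of derivatives of the coordinates along a vector field. -/
def chartDeriv (hV : V ≤ chartDom n x₀) : VecField n V →ₗ[Smooth n V] (Fin n → Smooth n V) where
  toFun X j := lieDer V X (chartCoord hV j)
  map_add' X Y := by
    funext j
    rw [map_add]
    rfl
  map_smul' a X := by
    funext j
    rw [map_smul]
    rfl

theorem chartDeriv_chartFrame (hV : V ≤ chartDom n x₀) (i : Fin n) :
    chartDeriv hV (chartFrame hV i) = Pi.single i 1 := by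
  funext j
  refine (lieDer_chartFrame_chartCoord hV i j).trans ?_
  rw [Pi.single_apply]
  simp only [eq_comm]

/-- Vector fields on `V` correspond to the families of derivatives of the coordinates. -/
def chartEquiv (hV : V ≤ chartDom n x₀) : VecField n V ≃ₗ[Smooth n V] (Fin n → Smooth n V) :=
  LinearEquiv.ofBijective (chartDeriv hV)
    ⟨fun X Y h => vecField_ext_chartCoord hV fun j => congrFun h j, fun a => by
      refine ⟨∑ j, a j • chartFrame hV j, ?_⟩
      simp only [map_sum, map_smul, chartDeriv_chartFrame]
      exact (pi_eq_sum_univ' a).symm⟩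

/-- The coordinate vector fields as a basis of the vector fields on `V`. -/
def chartBasis (hV : V ≤ chartDom n x₀) : Module.Basis (Fin n) (Smooth n V) (VecField n V) :=
  Module.Basis.ofEquivFun (chartEquiv hV)

theorem chartBasis_apply (hV : V ≤ chartDom n x₀) (i : Fin n) :
    chartBasis hV i = chartFrame hV i := by
  rw [chartBasis, Module.Basis.coe_ofEquivFun, LinearEquiv.symm_apply_eq]
  exact (chartDeriv_chartFrame hV i).symm

theorem vecRes_chartFrame {W : Opens M} (hV : V ≤ chartDom n x₀) (h : W ≤ V) (i : Fin n) :
    vecRes h (chartFrame hV i) = chartFrame (h.trans hV) i := by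
  refine vecField_ext_chartCoord (h.trans hV) fun j => ?_
  have e : chartCoord (h.trans hV) j = res h (chartCoord hV j) := rfl
  rw [lieDer_chartFrame_chartCoord, e, lieDer_res, lieDer_chartFrame_chartCoord]
  split_ifs <;> simp

/-- Hadamard's lemma on `V`, near a point. -/
theorem exists_eventually_eq_sum (hV : V ≤ chartDom n x₀) (f : Smooth n V) (p : V) :
    ∃ g : Fin n → Smooth n V, ∀ᶠ y in nhds p,
      f y = f p + ∑ j, (chartCoord hV j y - chartCoord hV j p) * g j y := by
  obtain ⟨r, hr, hev, hrs⟩ := exists_chartMap_inverse hV p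
  set q := chartMap n x₀ V p
  have hfr : ∀ᶠ z in nhds q, ContDiffAt ℝ ∞ (f ∘ r) z := by
    filter_upwards [hev] with z hz
    rw [← contMDiffAt_iff_contDiffAt]
    refine ContMDiffAt.comp z (f.contMDiff (r z)) ?_
    have h := hrs (r z)
    rwa [hz] at h
  -- A smooth function on Euclidean space that agrees with `f` in the chart near the point.
  obtain ⟨F, hF, hFf⟩ := exists_contDiff_eventuallyEq hfr
  obtain ⟨G, hG, hFG⟩ := hadamard hF q
  refine ⟨fun j => ⟨fun y => G j (chartMap n x₀ V y),
    (hG j).contMDiff.comp (contMDiff_chartMap hV)⟩, ?_⟩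
  have h1 : ∀ᶠ y in nhds p, F (chartMap n x₀ V y) = f (r (chartMap n x₀ V y)) :=
    (contMDiff_chartMap hV).continuous.continuousAt.eventually hFf
  filter_upwards [h1] with y hy
  have h2 := h1.self_of_nhds
  rw [hr] at hy h2
  rw [← hy, ← h2]
  exact hFG _

variable [T2Space M]

/-- The chart gives a coordinate frame: by Hadamard's lemma, an operator commuting with the
coordinates commutes with all functions. -/
theorem isCoordFrame_chart (hV : V ≤ chartDom n x₀) :
    IsCoordFrame (k := ℝ) (chartCoord hV) fun j => lieDer V (chartBasis hV j) where
  apply_coord i j := by rw [chartBasis_apply, lieDer_chartFrame_chartCoord]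
  mem_zero D hD h := by
    rw [mem_diffOp_zero]
    -- Evaluate `D` at `p` on the expansion of `f` given by Hadamard's lemma: `D` commutes with the
    -- coordinates, and their differences vanish at `p`.
    have h1 : ∀ f : Smooth n V, D f = f * D 1 := by
      intro f
      ext p
      obtain ⟨g, hg⟩ := exists_eventually_eq_sum hV f p
      let ev : Smooth n V →ₗ[ℝ] ℝ := ⟨⟨fun f => f p, fun _ _ => rfl⟩, fun _ _ => rfl⟩
      have hx : ∀ j (a : Smooth n V), D (chartCoord hV j * a) = chartCoord hV j * D a := by
        intro j a
        exact sub_eq_zero.1 (LinearMap.congr_fun (h j) a)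
      have h2 : D f p = D (f p • 1 +
          ∑ j, (chartCoord hV j * g j - chartCoord hV j p • g j)) p := by
        refine diffOp_local hD ?_
        filter_upwards [hg] with y hy
        let ev' : Smooth n V →ₗ[ℝ] ℝ := ⟨⟨fun f => f y, fun _ _ => rfl⟩, fun _ _ => rfl⟩
        rw [hy]
        change _ = ev' (f p • 1 + ∑ j, (chartCoord hV j * g j - chartCoord hV j p • g j))
        rw [map_add, map_sum]
        congr 1
        · exact (mul_one _).symm
        · exact Finset.sum_congr rfl fun j _ => sub_mul _ _ _
      rw [h2]
      change ev _ = f p * D 1 p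
      simp only [map_add, map_sum, map_sub, map_smul, hx]
      rw [Finset.sum_eq_zero fun j _ => sub_eq_zero.2 rfl, add_zero]
      rfl
    intro a b
    rw [h1, h1 b, mul_assoc]

end ChartFrame

end DiffOps

/-! ### From sections over chart domains to sheaves -/

namespace DiffOps

section Locality

variable {n : ℕ} {M : Type u} [TopologicalSpace M] [ChartedSpace (EuclideanSpace ℝ (Fin n)) M]

theorem mem_chartDom (x : M) : x ∈ chartDom n x :=
  mem_chart_source (EuclideanSpace ℝ (Fin n)) x

variable (n M) in
theorem coversTop_chartDom :
    (Opens.grothendieckTopology M).CoversTop fun x : M => chartDom n x := by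
  intro U x hx
  exact ⟨U ⊓ chartDom n x, homOfLE inf_le_left, (Sieve.mem_ofObjects_iff ..).2
    ⟨x, ⟨homOfLE inf_le_right⟩⟩, hx, mem_chartDom x⟩

variable {A : Type*} [Category A] {FA : A → A → Type*} {CA : A → Type*}
  [∀ X Y, FunLike (FA X Y) (CA X) (CA Y)] [ConcreteCategory A FA] {P Q : (Opens M)ᵒᵖ ⥤ A}

/-- A morphism of presheaves that is injective on the open subsets of chart domains is locally
injective. -/
theorem isLocallyInjective_of_chartDom (φ : P ⟶ Q)
    (h : ∀ (x : M) (V : Opens M), V ≤ chartDom n x → Function.Injective (φ.app (op V))) :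
    Presheaf.IsLocallyInjective (Opens.grothendieckTopology M) φ where
  equalizerSieve_mem {U} s t hst := fun x hx => by
    refine ⟨U.unop ⊓ chartDom n x, homOfLE inf_le_left, ?_, hx, mem_chartDom x⟩
    refine h x _ inf_le_right ?_
    rw [NatTrans.naturality_apply, NatTrans.naturality_apply, hst]

/-- A morphism of presheaves that is surjective on the open subsets of chart domains is locally
surjective. -/
theorem isLocallySurjective_of_chartDom (φ : P ⟶ Q)
    (h : ∀ (x : M) (V : Opens M), V ≤ chartDom n x → Function.Surjective (φ.app (op V))) :
    Presheaf.IsLocallySurjective (Opens.grothendieckTopology M) φ where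
  imageSieve_mem {U} s := fun x hx => by
    refine ⟨U ⊓ chartDom n x, homOfLE inf_le_left, ?_, hx, mem_chartDom x⟩
    exact h x _ inf_le_right _

end Locality

section Restriction

variable {n : ℕ} {M : Type u} [TopologicalSpace M] [ChartedSpace (EuclideanSpace ℝ (Fin n)) M]
  [IsManifold (𝓡 n) ∞ M] [T2Space M] {x₀ : M} {V W : Opens M}

/-- The derivations given by the coordinate vector fields of the chart at `x₀`, on `V`. -/
abbrev chartDer (hV : V ≤ chartDom n x₀) (j : Fin n) :
    Derivation ℝ (Smooth n V) (Smooth n V) :=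
  lieDer V (chartBasis hV j)

theorem symbAlgRes_frameSymb (hV : V ≤ chartDom n x₀) (h : W ≤ V) (j : Fin n) :
    symbAlgRes h (frameSymb (chartDer hV) j) = frameSymb (chartDer (h.trans hV)) j := by
  refine (symbAlgRes_of h 1 _).trans (congrArg _ ?_)
  refine symbRes_mk h (derivation_mem _) (derivation_mem _) fun f => ?_
  change lieDer W (chartBasis _ j) (res h f) = res h (lieDer V (chartBasis hV j) f)
  rw [chartBasis_apply, chartBasis_apply, ← vecRes_chartFrame hV h, lieDer_res]

theorem symbAlgRes_polySymb_monomial (hV : V ≤ chartDom n x₀) (h : W ≤ V) (m : Fin n →₀ ℕ) :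
    symbAlgRes h (polySymb (chartDer hV) (MvPolynomial.monomial m 1)) =
      polySymb (chartDer (h.trans hV)) (MvPolynomial.monomial m 1) := by
  simp only [polySymb, MvPolynomial.aeval_monomial, map_one, one_mul, Finsupp.prod, map_prod,
    map_pow, symbAlgRes_frameSymb hV h]

theorem symbRes_monomialSymb (hV : V ≤ chartDom n x₀) (h : W ≤ V) (i : ℕ)
    (m : {m : Fin n →₀ ℕ // m.degree = i}) :
    symbRes h i (monomialSymb (chartDer hV) i m) = monomialSymb (chartDer (h.trans hV)) i m := by
  refine DirectSum.of_injective (β := Symb ℝ (Smooth n W)) i ?_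
  rw [← symbAlgRes_of, of_monomialSymb, of_monomialSymb, symbAlgRes_polySymb_monomial]

theorem symbAlgRes_smul (h : W ≤ V) (a : Smooth n V) (s : SymbAlg ℝ (Smooth n V)) :
    symbAlgRes h (a • s) = res h a • symbAlgRes h s := by
  refine (congrArg (symbAlgRes h) (Algebra.smul_def a s)).trans ?_
  rw [map_mul, symbAlgRes_algebraMap]
  exact (Algebra.smul_def (res h a) (symbAlgRes h s)).symm

end Restriction

section Sheaves

variable (n : ℕ) (M : Type u) [TopologicalSpace M] [ChartedSpace (EuclideanSpace ℝ (Fin n)) M]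
  [IsManifold (𝓡 n) ∞ M] [T2Space M]

theorem isIso_symbolMap : IsIso (symbolMap n M) := by
  have h : ∀ (x : M) (V : Opens M), V ≤ chartDom n x →
      Function.Bijective ((symbolPresheafMap n M).app (op V)) := fun x V hV =>
    (isCoordFrame_chart hV).symbolHom_bijective (chartBasis hV)
  have h1 := isLocallyInjective_of_chartDom (symbolPresheafMap n M) fun x V hV => (h x V hV).1
  have h2 := isLocallySurjective_of_chartDom (symbolPresheafMap n M) fun x V hV => (h x V hV).2
  have h3 : IsIso ((presheafToSheaf (Opens.grothendieckTopology M) CommRingCat.{u}).map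
      (symbolPresheafMap n M)) :=
    ((Opens.grothendieckTopology M).W_iff _).1
      ((Opens.grothendieckTopology M).W_of_isLocallyBijective _)
  have h4 : IsIso ((Under.forget _).map (symbolMap n M)) := h3
  exact isIso_of_reflects_iso (symbolMap n M) (Under.forget _)

theorem isIso_symbolMapDeg (i : ℕ) : IsIso (symbolMapDeg n M i) := by
  let φ := (PresheafOfModules.toPresheaf _).map (symbolDegPresheafMap n M i)
  have h : ∀ (x : M) (V : Opens M), V ≤ chartDom n x →
      Function.Bijective (φ.app (op V)) := fun x V hV =>
    (isCoordFrame_chart hV).symbolHomDeg_bijective (chartBasis hV) i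
  have h1 := isLocallyInjective_of_chartDom φ fun x V hV => (h x V hV).1
  have h2 := isLocallySurjective_of_chartDom φ fun x V hV => (h x V hV).2
  have h3 : IsIso ((presheafToSheaf (Opens.grothendieckTopology M) AddCommGrpCat.{u}).map φ) :=
    ((Opens.grothendieckTopology M).W_iff _).1
      ((Opens.grothendieckTopology M).W_of_isLocallyBijective _)
  have h4 : IsIso ((SheafOfModules.toSheaf _).map (symbolMapDeg n M i)) := h3
  exact isIso_of_reflects_iso (symbolMapDeg n M i) (SheafOfModules.toSheaf _)

variable {n M} in
/-- The canonical morphism from a presheaf of modules to its associated sheaf. -/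
def toSheafModules (P : PresheafOfModules.{u} (smoothRingSheaf n M).obj) :
    P ⟶ ((sheafModules n M).obj P).val :=
  PresheafOfModules.homMk (toSheafify (Opens.grothendieckTopology M) P.presheaf) fun X r m =>
    (((PresheafOfModules.sheafificationAdjunction (𝟙 (smoothRingSheaf n M).obj)).unit.app P).app
      X).hom.map_smul r m

theorem isLocallyFree_symbSheafDeg (i : ℕ) : (symbSheafDeg n M i).IsLocallyFree := by
  let P := symbDegPresheaf n M i
  let f : P ⟶ (symbSheafDeg n M i).val := toSheafModules P
  have h1 : PresheafOfModules.IsLocallyInjective (Opens.grothendieckTopology M) f :=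
    inferInstanceAs (Presheaf.IsLocallyInjective _ (toSheafify _ P.presheaf))
  have h2 : PresheafOfModules.IsLocallySurjective (Opens.grothendieckTopology M) f :=
    inferInstanceAs (Presheaf.IsLocallySurjective _ (toSheafify _ P.presheaf))
  choose e he using fun (x : M) (Y : Over (chartDom n x)) =>
    (isCoordFrame_chart (leOfHom Y.hom)).exists_basisDeg (chartBasis (leOfHom Y.hom)) i
  have hb : ∀ (x : M) (Y : Over (chartDom n x)) (m : ULift.{u} {m : Fin n →₀ ℕ // m.degree = i}),
      (e x Y).reindex Equiv.ulift.symm m = monomialSymb (chartDer (leOfHom Y.hom)) i m.down :=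
    fun x Y m => (Module.Basis.reindex_apply _ _ _).trans (he x Y _)
  refine SheafOfModules.isLocallyFree_of_basis.{u, u, u} f (coversTop_chartDom n M)
    (I := ULift.{u} {m : Fin n →₀ ℕ // m.degree = i})
    (fun x Y => (e x Y).reindex Equiv.ulift.symm) fun x Y Z g m => ?_
  exact (congrArg (symbRes (leOfHom g.left) i) (hb x Z m)).trans
    ((symbRes_monomialSymb (leOfHom Z.hom) (leOfHom g.left) i m.down).trans (hb x Y m).symm)

/-- The presheaf of modules `U ↦ Symb^*(C^∞(U))`. -/
def symbAlgPresheaf : PresheafOfModules.{u} (smoothRingSheaf n M).obj where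
  obj U := ModuleCat.of (Smooth n U.unop) (SymbAlg ℝ (Smooth n U.unop))
  map {U V} f := ModuleCat.ofHom (R := Smooth n U.unop)
    (Y := (ModuleCat.restrictScalars (res (leOfHom f.unop))).obj
      (ModuleCat.of (Smooth n V.unop) (SymbAlg ℝ (Smooth n V.unop))))
    { toFun := fun x => symbAlgRes (leOfHom f.unop) x
      map_add' := fun x y => map_add _ x y
      map_smul' := fun a x => symbAlgRes_smul (leOfHom f.unop) a x }
  map_id _ := ModuleCat.hom_ext (LinearMap.ext fun x => RingHom.congr_fun symbAlgRes_id x)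
  map_comp f g := ModuleCat.hom_ext (LinearMap.ext fun x =>
    RingHom.congr_fun (symbAlgRes_comp (leOfHom f.unop) (leOfHom g.unop)) x)

/-- The canonical morphism from `U ↦ Symb^*(C^∞(U))` to its associated sheaf of algebras, as a
morphism of presheaves of modules. -/
def symbAlgToSheaf : symbAlgPresheaf n M ⟶ (toModules (symbSheaf n M)).val :=
  PresheafOfModules.homMk
    { app := fun U => AddCommGrpCat.ofHom
        ((toSheafify (Opens.grothendieckTopology M) (symbPresheaf n M)).app U).hom.toAddMonoidHom
      naturality := fun U V f => by
        refine AddCommGrpCat.hom_ext (AddMonoidHom.ext fun x => ?_)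
        exact NatTrans.naturality_apply
          (toSheafify (Opens.grothendieckTopology M) (symbPresheaf n M)) f x }
    fun U a x => by
      have h := map_mul ((toSheafify (Opens.grothendieckTopology M) (symbPresheaf n M)).app U).hom
        (algebraMap (Smooth n U.unop) (SymbAlg ℝ (Smooth n U.unop)) a) x
      have e := Algebra.smul_def (R := Smooth n U.unop) (A := SymbAlg ℝ (Smooth n U.unop)) a x
      exact (congrArg _ e).trans h

theorem isLocallyFree_symbSheaf : (toModules (symbSheaf n M)).IsLocallyFree := by
  let φ := toSheafify (Opens.grothendieckTopology M) (symbPresheaf n M)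
  have i1 : Presheaf.IsLocallyInjective (Opens.grothendieckTopology M) φ := inferInstance
  have i2 : Presheaf.IsLocallySurjective (Opens.grothendieckTopology M) φ := inferInstance
  have h1 : PresheafOfModules.IsLocallyInjective (Opens.grothendieckTopology M)
      (symbAlgToSheaf n M) := ⟨fun s t h => i1.equalizerSieve_mem s t h⟩
  have h2 : PresheafOfModules.IsLocallySurjective (Opens.grothendieckTopology M)
      (symbAlgToSheaf n M) := ⟨fun s => i2.imageSieve_mem s⟩
  let b (x : M) (Y : Over (chartDom n x)) :=
    ((isCoordFrame_chart (leOfHom Y.hom)).basis (chartBasis (leOfHom Y.hom))).reindex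
      (Equiv.ulift.{u}.symm : (Fin n →₀ ℕ) ≃ ULift.{u} (Fin n →₀ ℕ))
  have hb : ∀ (x : M) (Y : Over (chartDom n x)) (m : ULift.{u} (Fin n →₀ ℕ)), b x Y m =
      polySymb (chartDer (leOfHom Y.hom)) (MvPolynomial.monomial m.down 1) :=
    fun x Y m => (Module.Basis.reindex_apply _ _ _).trans (IsCoordFrame.basis_apply _ _ _)
  refine SheafOfModules.isLocallyFree_of_basis.{u, u, u} (symbAlgToSheaf n M)
    (coversTop_chartDom n M) b fun x Y Z g m => ?_
  exact (congrArg (symbAlgRes (leOfHom g.left)) (hb x Z m)).trans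
    ((symbAlgRes_polySymb_monomial (leOfHom Z.hom) (leOfHom g.left) m.down).trans (hb x Y m).symm)

end Sheaves

end DiffOps

end

theorem mainTheorem1 (n : ℕ) (M : Type u) [TopologicalSpace M] [T2Space M]
    [SecondCountableTopology M] [ChartedSpace (EuclideanSpace ℝ (Fin n)) M]
    [IsManifold (𝓡 n) ∞ M] :
    IsIso (DiffOps.symbolMap n M) ∧
    (∀ i : ℕ, IsIso (DiffOps.symbolMapDeg n M i)) ∧
    (DiffOps.toModules (DiffOps.symbSheaf n M)).IsLocallyFree ∧
    (∀ i : ℕ, (DiffOps.symbSheafDeg n M i).IsLocallyFree) :=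
  ⟨DiffOps.isIso_symbolMap n M, DiffOps.isIso_symbolMapDeg n M,
    DiffOps.isLocallyFree_symbSheaf n M, DiffOps.isLocallyFree_symbSheafDeg n M⟩
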